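/- Let $f,g:\mathbb{R}^n\to\mathbb{R}\cup\{+\infty\}$ be proper, lower semicontinuous and convex. Assume that $f$ is standard self-concordant: $\operatorname{dom} f=\{f<+\infty\}$ is open, $f$ is three times continuously differentiable on it, and for all $x\in\operatorname{dom} f$, $v\in\mathbb{R}^n$, the function $\varphi(t)=f(x+tv)$ satisfies $|\varphi'''(t)|\le 2\varphi''(t)^{3/2}$ whenever $x+tv\in\operatorname{dom} f$. Let $F=f+g$, $\operatorname{dom}F=\operatorname{dom} f\cap\operatorname{dom} g$. Assume that $x^*\in\operatorname{dom}F$ is the unique minimizer of $F$ over $\mathbb{R}^n$ and is strongly regular, i.e. $\nabla^2 f(x^*)\succ0$. Write $\|v\|_{x^*}=(v^T\nabla^2 f(x^*)v)^{1/2}$ and $\|v\|^*_{x^*}=(v^T\nabla^2 f(x^*)^{-1}v)^{1/2}$. A sequence $(x^k)_{k\ge0}$ is generated by the full-step proximal quasi-Newton scheme with matrices $(H_k)_{k\ge0}$ if $x^0\in\operatorname{dom}F$ and, for all $k\ge0$, $x^{k+1}=x^k+d^k$ with $d^k=s^k-x^k$ and $$s^k\in\operatorname*{arg\,min}_{x\in\operatorname{dom}F}\Big\{f(x^k)+\nabla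 f(x^k)^T(x-x^k)+\tfrac12(x-x^k)^TH_k(x-x^k)+g(x)\Big\}$$ (a minimizer $s^k$ is assumed to exist at every iteration). Put $z^k=x^{k+1}-x^k$ and $y^k=\nabla f(x^{k+1})-\nabla f(x^k)$. The secant equation is $H_{k+1}z^k=y^k$ for all $k\ge0$. "$x^k\to x^*$ superlinearly" means that $x^k\to x^*$ and $\|x^{k+1}-x^*\|_{x^*}=o(\|x^k-x^*\|_{x^*})$ as $k\to\infty$. (a) Let $(x^k)$ be generated by the scheme with symmetric positive definite matrices $H_k$ that satisfy the secant equation and the Dennis–Moré condition $$\lim_{k\to\infty}\frac{\|(H_k-\nabla^2 f(x^*))(x^{k+1}-x^k)\|^*_{x^*}}{\|x^{k+1}-x^k\|_{x^*}}=0$$ (the quotient being read as $0$ when $x^{k+1}=x^k$). If $\|x^0-x^*\|_{x^*}<1$, then $x^k\to x^*$ superlinearly. (b) Let $H_0$ be symmetric positive definite, and let $(x^k)$ be generated by the scheme with matrices $H_k$ given by the BFGS updates $$H_{k+1}=H_k+\frac{1}{(y^k)^Tz^k}\,y^k(y^k)^T-\frac{1}{(z^k)^TH_kz^k}\,H_kz^k(H_kz^k)^T,$$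 where $H_{k+1}=H_k$ if $z^k=0$. Then $(y^k)^Tz^k>0$ for every $k\ge0$ with $x^k\ne x^*$ (that is, as long as the solution has not been reached), all matrices $H_k$ are symmetric positive definite, and they satisfy the secant equation. If, moreover, $\sum_{k=0}^\infty\|x^k-x^*\|_{x^*}<+\infty$, then $x^k\to x^*$ superlinearly. -/

import Mathlib

/-- The space `ℝⁿ` with its Euclidean structure. -/
abbrev RVec (n : ℕ) : Type := EuclideanSpace ℝ (Fin n)

/-- Square real matrices of size `n`. -/
abbrev RMat (n : ℕ) : Type := Matrix (Fin n) (Fin n) ℝ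

/-- The domain `dom f = {x | f x < +∞}` of an extended-real-valued function. -/
def effDom {n : ℕ} (f : RVec n → EReal) : Set (RVec n) :=
  {x | f x < ⊤}

/-- Proper, lower semicontinuous (closed), convex functions `ℝⁿ → ℝ ∪ {+∞}`;
convexity is convexity of the epigraph. -/
structure IsProperClosedConvex {n : ℕ} (f : RVec n → EReal) : Prop where
  ne_bot : ∀ x, f x ≠ ⊥
  dom_nonempty : (effDom f).Nonempty
  lsc : LowerSemicontinuous f
  convex_epigraph : Convex ℝ {p : RVec n × ℝ | f p.1 ≤ (p.2 : EReal)}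

/-- The real-valued function that agrees with `f` on `dom f` (its values outside `dom f` are
never used: `dom f` is open for all the functions which are differentiated). -/
noncomputable def realValue {n : ℕ} (f : RVec n → EReal) (x : RVec n) : ℝ :=
  (f x).toReal

/-- Standard self-concordant functions: closed convex, with open domain, three times continuously
differentiable there, and `|φ'''(t)| ≤ 2 φ''(t)^{3/2}` for every restriction `φ(t) = f(x + t v)`
at every `t` with `x + t v ∈ dom f`. -/
structure IsStdSelfConcordant {n : ℕ} (f : RVec n → EReal) : Prop where
  properClosedConvex : IsProperClosedConvex f
  isOpen_dom : IsOpen (effDom f)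
  contDiffOn : ContDiffOn ℝ 3 (realValue f) (effDom f)
  third_le : ∀ x ∈ effDom f, ∀ (v : RVec n) (t : ℝ), x + t • v ∈ effDom f →
    |iteratedDeriv 3 (fun s : ℝ => realValue f (x + s • v)) t| ≤
      2 * (iteratedDeriv 2 (fun s : ℝ => realValue f (x + s • v)) t) ^ ((3 : ℝ) / 2)

/-- The gradient `∇f(x)`. -/
noncomputable def grad {n : ℕ} (f : RVec n → EReal) (x : RVec n) : RVec n :=
  gradient (realValue f) x

/-- The Hessian matrix `∇²f(x)`, with entries `D²f(x)[eᵢ, eⱼ]`. -/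
noncomputable def hessianMatrix {n : ℕ} (f : RVec n → EReal) (x : RVec n) : RMat n :=
  Matrix.of fun i j =>
    fderiv ℝ (fun y => fderiv ℝ (realValue f) y) x
      (EuclideanSpace.single i 1) (EuclideanSpace.single j 1)

/-- The matrix-vector product `H v` in `ℝⁿ`. -/
noncomputable def matVec {n : ℕ} (H : RMat n) (v : RVec n) : RVec n :=
  WithLp.toLp 2 (H.mulVec v.ofLp)

/-- The weighted norm `‖v‖_H = (vᵀ H v)^{1/2}`. -/
noncomputable def weightedNorm {n : ℕ} (H : RMat n) (v : RVec n) : ℝ :=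
  Real.sqrt (inner ℝ v (matVec H v))

/-- The local norm `‖v‖_x = (vᵀ ∇²f(x) v)^{1/2}`. -/
noncomputable def localNorm {n : ℕ} (f : RVec n → EReal) (x v : RVec n) : ℝ :=
  weightedNorm (hessianMatrix f x) v

/-- The dual local norm `‖v‖_x^* = (vᵀ ∇²f(x)⁻¹ v)^{1/2}` (used only where `∇²f(x) ≻ 0`). -/
noncomputable def dualLocalNorm {n : ℕ} (f : RVec n → EReal) (x v : RVec n) : ℝ :=
  weightedNorm (hessianMatrix f x)⁻¹ v

/-- The composite objective `F = f + g`. -/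
noncomputable def compositeObj {n : ℕ} (f g : RVec n → EReal) (x : RVec n) : EReal :=
  f x + g x

/-- `x` is a solution of `min F`: a point of `dom F` at which `F` is minimal over `ℝⁿ`. -/
def IsCompositeSolution {n : ℕ} (f g : RVec n → EReal) (x : RVec n) : Prop :=
  x ∈ effDom (compositeObj f g) ∧ ∀ y, compositeObj f g x ≤ compositeObj f g y

/-- `xs` is the unique solution of `min F`. -/
def IsUniqueCompositeSolution {n : ℕ} (f g : RVec n → EReal) (xs : RVec n) : Prop :=
  IsCompositeSolution f g xs ∧ ∀ x, IsCompositeSolution f g x → x = xs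

/-- A solution is strongly regular if the Hessian of `f` is positive definite there. -/
def IsStronglyRegular {n : ℕ} (f : RVec n → EReal) (xs : RVec n) : Prop :=
  (hessianMatrix f xs).PosDef

/-- The quadratic surrogate
`Q(x; xk, H) = f(xk) + ∇f(xk)ᵀ(x - xk) + ½ (x - xk)ᵀ H (x - xk)`. -/
noncomputable def surrogate {n : ℕ} (f : RVec n → EReal) (xk : RVec n) (H : RMat n)
    (x : RVec n) : ℝ :=
  realValue f xk + inner ℝ (grad f xk) (x - xk) + (1 / 2) * inner ℝ (x - xk) (matVec H (x - xk))

/-- The solution set `argmin_{x ∈ dom F} { Q(x; xk, H) + g(x) }` of the subproblem. -/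
def subproblemSolutions {n : ℕ} (f g : RVec n → EReal) (xk : RVec n) (H : RMat n) :
    Set (RVec n) :=
  {s | s ∈ effDom (compositeObj f g) ∧ ∀ x ∈ effDom (compositeObj f g),
    (surrogate f xk H s : EReal) + g s ≤ (surrogate f xk H x : EReal) + g x}

/-- The full-step scheme with variable metrics `H k`, started in `dom F`:
`x^{k+1} = x^k + d^k` with `d^k = s^k - x^k` and `s^k` a solution of the subproblem at
`(x^k, H k)`. -/
def IsFullStepScheme {n : ℕ} (f g : RVec n → EReal) (x : ℕ → RVec n) (H : ℕ → RMat n) : Prop :=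
  x 0 ∈ effDom (compositeObj f g) ∧
    ∀ k, ∃ s ∈ subproblemSolutions f g (x k) (H k), x (k + 1) = x k + (s - x k)

/-- The step `z^k = x^{k+1} - x^k`. -/
def stepVec {n : ℕ} (x : ℕ → RVec n) (k : ℕ) : RVec n :=
  x (k + 1) - x k

/-- The gradient difference `y^k = ∇f(x^{k+1}) - ∇f(x^k)`. -/
noncomputable def gradDiff {n : ℕ} (f : RVec n → EReal) (x : ℕ → RVec n) (k : ℕ) : RVec n :=
  grad f (x (k + 1)) - grad f (x k)

/-- The secant equation `H_{k+1} (x^{k+1} - x^k) = ∇f(x^{k+1}) - ∇f(x^k)` for all `k`. -/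
def SatisfiesSecant {n : ℕ} (f : RVec n → EReal) (x : ℕ → RVec n) (H : ℕ → RMat n) : Prop :=
  ∀ k, matVec (H (k + 1)) (stepVec x k) = gradDiff f x k

/-- The Dennis–Moré condition
`‖(H_k - ∇²f(x*)) (x^{k+1} - x^k)‖*_{x*} / ‖x^{k+1} - x^k‖_{x*} → 0`.
(If `x^{k+1} = x^k`, then the numerator and the denominator vanish and the quotient is `0`.) -/
def DennisMore {n : ℕ} (f : RVec n → EReal) (xs : RVec n) (x : ℕ → RVec n)
    (H : ℕ → RMat n) : Prop :=
  Filter.Tendsto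
    (fun k => dualLocalNorm f xs (matVec (H k - hessianMatrix f xs) (stepVec x k)) /
      localNorm f xs (stepVec x k))
    Filter.atTop (nhds 0)

/-- The BFGS update `H + (yᵀz)⁻¹ y yᵀ - (zᵀHz)⁻¹ (Hz)(Hz)ᵀ`.
For a zero step (`z = 0` and `y = 0`) the two rank-one terms are `0` and `H` is kept. -/
noncomputable def bfgsUpdate {n : ℕ} (H : RMat n) (y z : RVec n) : RMat n :=
  H + (1 / inner ℝ y z) • Matrix.vecMulVec y.ofLp y.ofLp
    - (1 / inner ℝ z (matVec H z)) • Matrix.vecMulVec (matVec H z).ofLp (matVec H z).ofLp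

/-- The matrices `H k` are generated from `H 0` by the BFGS formula along `x`. -/
def IsBFGSSequence {n : ℕ} (f : RVec n → EReal) (x : ℕ → RVec n) (H : ℕ → RMat n) : Prop :=
  ∀ k, H (k + 1) = bfgsUpdate (H k) (gradDiff f x k) (stepVec x k)

/-- `x^k → x*` at a (Q-)superlinear rate: `x^k → x*` and
`‖x^{k+1} - x*‖_{x*} = o(‖x^k - x*‖_{x*})`. -/
def ConvergesSuperlinearly {n : ℕ} (f : RVec n → EReal) (xs : RVec n) (x : ℕ → RVec n) : Prop :=
  Filter.Tendsto x Filter.atTop (nhds xs) ∧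
    Asymptotics.IsLittleO Filter.atTop
      (fun k => localNorm f xs (x (k + 1) - xs)) (fun k => localNorm f xs (x k - xs))

/-! Write G = ∇²f(x*) and z_k = x^{k+1} - x^k. Optimality of the subproblem says that -∇f(x^k) - H_k
z_k is a subgradient of g at x^{k+1}, relative to dom F. Monotonicity of these subgradients between
two consecutive iterates, with y^k replaced by H_{k+1} z_k through the secant equation, gives
⟨z_{k+1}, H_{k+1} z_{k+1}⟩ ≤ ⟨z_{k+1}, H_k z_k⟩ - ⟨z_k, H_{k+1} z_{k+1}⟩. Replace each H z by G z
plus its Dennis–Moré error. The two G cross terms cancel by symmetry, so ‖z_{k+1}‖² is bounded by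
error terms only, and ‖z_{k+1}‖ ≤ δ_k ‖z_k‖ with δ_k → 0 (`IsFullStepScheme.exists_norm_step_le`).
Such a sequence converges superlinearly to some limit (`exists_tendsto_of_norm_step_le`).

The limit is x* (`IsFullStepScheme.tendsto_solution`): comparing the subgradients at x^{k+1} and x*
bounds ⟨∇f(x^k) - ∇f(x*), x^{k+1} - x*⟩ by a null sequence. Inside dom f, strict monotonicity of ∇f
then forces equality; a limit outside dom f is excluded because f(x^k) would have to blow up. Strict
monotonicity is where self-concordance enters: the kernel of ∇²f is the same at all points, hence
trivial everywhere once G is positive definite.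

For BFGS, strict monotonicity gives (y^k)ᵀz_k > 0 for nonzero steps, hence positive definiteness and
the secant equation. The Dennis–Moré condition comes from the potential tr(G⁻¹H) - log det H, which
is bounded below. One update lowers it by some c_k ≥ 0, up to an error proportional to the relative
secant error ‖y^k - G z_k‖*/‖z_k‖. By local Lipschitz continuity of ∇²f these errors are summable
when the distances to x* are, so c_k → 0; and c_k controls the Dennis–Moré quotient
(`bfgsPotential_step`). The argument of the first two paragraphs then applies. -/

/-! ### Quadratic forms of positive definite matrices and the algebra of the BFGS update. -/

section Matrices

variable {n : ℕ}

theorem inner_eq_dotProduct (v w : RVec n) : inner ℝ v w = v.ofLp ⬝ᵥ w.ofLp := by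
  rw [EuclideanSpace.inner_eq_star_dotProduct, dotProduct_comm]
  simp

theorem ofLp_matVec (H : RMat n) (v : RVec n) : (matVec H v).ofLp = H.mulVec v.ofLp := rfl

theorem inner_matVec (H : RMat n) (v w : RVec n) :
    inner ℝ v (matVec H w) = v.ofLp ⬝ᵥ H.mulVec w.ofLp := by
  rw [inner_eq_dotProduct, ofLp_matVec]

theorem matVec_add (H : RMat n) (v w : RVec n) : matVec H (v + w) = matVec H v + matVec H w := by
  ext i
  simp [matVec, Matrix.mulVec_add]

theorem matVec_sub (H : RMat n) (v w : RVec n) : matVec H (v - w) = matVec H v - matVec H w := by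
  ext i
  simp [matVec, Matrix.mulVec_sub]

theorem matVec_smul (H : RMat n) (c : ℝ) (v : RVec n) : matVec H (c • v) = c • matVec H v := by
  ext i
  simp [matVec, Matrix.mulVec_smul]

theorem matVec_zero (H : RMat n) : matVec H (0 : RVec n) = 0 := by
  ext i
  simp [matVec]

theorem sub_matVec (H K : RMat n) (v : RVec n) : matVec (H - K) v = matVec H v - matVec K v := by
  ext i
  simp [matVec, Matrix.sub_mulVec]

theorem matVec_mul (H K : RMat n) (v : RVec n) : matVec (H * K) v = matVec H (matVec K v) := by
  ext i
  simp [matVec, Matrix.mulVec_mulVec]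

theorem one_matVec (v : RVec n) : matVec (1 : RMat n) v = v := by
  ext i
  simp [matVec]

theorem inner_matVec_comm {H : RMat n} (hH : H.IsHermitian) (v w : RVec n) :
    inner ℝ v (matVec H w) = inner ℝ w (matVec H v) := by
  have hT : H.transpose = H := by simpa using hH.eq
  rw [inner_matVec, inner_matVec, Matrix.dotProduct_mulVec, ← Matrix.mulVec_transpose, hT,
    dotProduct_comm]

theorem inner_matVec_pos {H : RMat n} (hH : H.PosDef) {v : RVec n} (hv : v ≠ 0) :
    0 < inner ℝ v (matVec H v) := by
  have h0 : v.ofLp ≠ 0 := fun h => hv (by ext i; simp [h])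
  have := hH.dotProduct_mulVec_pos h0
  rw [inner_matVec]
  simpa using this

theorem inner_matVec_nonneg {H : RMat n} (hH : H.PosDef) (v : RVec n) :
    0 ≤ inner ℝ v (matVec H v) := by
  rcases eq_or_ne v 0 with rfl | hv
  · simp
  · exact (inner_matVec_pos hH hv).le

theorem posDef_of_inner_matVec_pos {H : RMat n} (hH : H.IsHermitian)
    (h : ∀ v : RVec n, v ≠ 0 → 0 < inner ℝ v (matVec H v)) : H.PosDef := by
  refine Matrix.PosDef.of_dotProduct_mulVec_pos hH fun v hv => ?_
  have := h (WithLp.toLp 2 v) (fun h0 => hv (by simpa using congrArg WithLp.ofLp h0))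
  rw [inner_matVec] at this
  simpa using this

theorem inner_matVec_smul_sub {H : RMat n} (hH : H.IsHermitian) (v w : RVec n) (a b : ℝ) :
    inner ℝ (a • v - b • w) (matVec H (a • v - b • w)) =
      a ^ 2 * inner ℝ v (matVec H v) - 2 * (a * b) * inner ℝ v (matVec H w)
        + b ^ 2 * inner ℝ w (matVec H w) := by
  rw [matVec_sub, matVec_smul, matVec_smul]
  simp only [inner_sub_left, inner_sub_right, real_inner_smul_left, real_inner_smul_right]
  rw [inner_matVec_comm hH w v]
  ring

theorem inner_matVec_sq_le {H : RMat n} (hH : H.PosDef) (v w : RVec n) :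
    inner ℝ v (matVec H w) ^ 2 ≤ inner ℝ v (matVec H v) * inner ℝ w (matVec H w) := by
  rcases eq_or_ne w 0 with rfl | hw
  · simp [matVec_zero]
  have hw' := inner_matVec_pos hH hw
  have h := inner_matVec_nonneg hH
    (inner ℝ w (matVec H w) • v - inner ℝ v (matVec H w) • w)
  rw [inner_matVec_smul_sub hH.isHermitian] at h
  have h2 : 0 ≤ inner ℝ w (matVec H w) *
      (inner ℝ v (matVec H v) * inner ℝ w (matVec H w) - inner ℝ v (matVec H w) ^ 2) := by
    nlinarith [h]
  have := nonneg_of_mul_nonneg_right h2 hw'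
  linarith

theorem matVec_inv_matVec {H : RMat n} (hH : H.PosDef) (v : RVec n) :
    matVec H⁻¹ (matVec H v) = v := by
  rw [← matVec_mul, Matrix.nonsing_inv_mul _ ((Matrix.isUnit_iff_isUnit_det _).1 hH.isUnit),
    one_matVec]

theorem matVec_matVec_inv {H : RMat n} (hH : H.PosDef) (v : RVec n) :
    matVec H (matVec H⁻¹ v) = v := by
  rw [← matVec_mul, Matrix.mul_nonsing_inv _ ((Matrix.isUnit_iff_isUnit_det _).1 hH.isUnit),
    one_matVec]

/-- Cauchy–Schwarz for the dual pair of norms of G⁻¹ and G: the form of G evaluated at v and G⁻¹e.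
-/
theorem inner_sq_le_inv {G : RMat n} (hG : G.PosDef) (e v : RVec n) :
    inner ℝ e v ^ 2 ≤ inner ℝ e (matVec G⁻¹ e) * inner ℝ v (matVec G v) := by
  have h := inner_matVec_sq_le hG v (matVec G⁻¹ e)
  rw [matVec_matVec_inv hG, real_inner_comm, real_inner_comm e (matVec G⁻¹ e)] at h
  linarith

theorem exists_norm_matVec_le (H : RMat n) : ∃ C : ℝ, 0 < C ∧ ∀ v : RVec n, ‖matVec H v‖ ≤ C * ‖v‖ := by
  let A : RVec n →ₗ[ℝ] RVec n :=
    { toFun := matVec H, map_add' := matVec_add H, map_smul' := matVec_smul H }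
  refine ⟨‖LinearMap.toContinuousLinearMap A‖ + 1, by positivity, fun v => ?_⟩
  have := (LinearMap.toContinuousLinearMap A).le_opNorm v
  have h2 : (LinearMap.toContinuousLinearMap A) v = matVec H v := rfl
  rw [h2] at this
  nlinarith [norm_nonneg v]

theorem exists_inner_matVec_le (H : RMat n) :
    ∃ C : ℝ, 0 < C ∧ ∀ v : RVec n, inner ℝ v (matVec H v) ≤ C * ‖v‖ ^ 2 := by
  obtain ⟨C, hC, h⟩ := exists_norm_matVec_le H
  refine ⟨C, hC, fun v => (real_inner_le_norm _ _).trans ?_⟩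
  nlinarith [h v, norm_nonneg v]

theorem exists_le_inner_matVec {H : RMat n} (hH : H.PosDef) :
    ∃ c : ℝ, 0 < c ∧ ∀ v : RVec n, c * ‖v‖ ^ 2 ≤ inner ℝ v (matVec H v) := by
  obtain ⟨C, hC, h⟩ := exists_inner_matVec_le H⁻¹
  refine ⟨C⁻¹, inv_pos.2 hC, fun v => ?_⟩
  rcases eq_or_ne v 0 with rfl | hv
  · simp
  have h1 := inner_sq_le_inv hH v v
  rw [real_inner_self_eq_norm_sq] at h1
  have h2 := h v
  have h3 := inner_matVec_nonneg hH v
  have hpos : 0 < ‖v‖ ^ 2 := by positivity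
  rw [inv_mul_le_iff₀ hC]
  have h4 : ‖v‖ ^ 2 * ‖v‖ ^ 2 ≤ ‖v‖ ^ 2 * (C * inner ℝ v (matVec H v)) := by
    nlinarith [mul_le_mul_of_nonneg_right h2 h3]
  exact le_of_mul_le_mul_left h4 hpos

theorem exists_weightedNorm_equiv {H : RMat n} (hH : H.PosDef) :
    ∃ c C : ℝ, 0 < c ∧ 0 < C ∧
      ∀ v : RVec n, c * ‖v‖ ≤ weightedNorm H v ∧ weightedNorm H v ≤ C * ‖v‖ := by
  obtain ⟨c, hc, h1⟩ := exists_le_inner_matVec hH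
  obtain ⟨C, hC, h2⟩ := exists_inner_matVec_le H
  refine ⟨√c, √C, Real.sqrt_pos.2 hc, Real.sqrt_pos.2 hC, fun v => ⟨?_, ?_⟩⟩
  · refine Real.le_sqrt_of_sq_le ?_
    rw [mul_pow, Real.sq_sqrt hc.le]
    exact h1 v
  · refine Real.sqrt_le_iff.2 ⟨by positivity, ?_⟩
    rw [mul_pow, Real.sq_sqrt hC.le]
    exact h2 v

theorem weightedNorm_sq {H : RMat n} (hH : H.PosDef) (v : RVec n) :
    weightedNorm H v ^ 2 = inner ℝ v (matVec H v) :=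
  Real.sq_sqrt (inner_matVec_nonneg hH v)

/-! ### The BFGS update -/

theorem matVec_bfgsUpdate (H : RMat n) (y z v : RVec n) :
    matVec (bfgsUpdate H y z) v = matVec H v + (inner ℝ y v / inner ℝ y z) • y
      - (inner ℝ (matVec H z) v / inner ℝ z (matVec H z)) • matVec H z := by
  ext i
  simp only [matVec, bfgsUpdate, inner_eq_dotProduct, Matrix.sub_mulVec, Matrix.add_mulVec,
    Matrix.smul_mulVec, Matrix.vecMulVec_mulVec, PiLp.sub_apply, PiLp.add_apply, PiLp.smul_apply,
    Pi.sub_apply, Pi.add_apply, Pi.smul_apply, smul_eq_mul, MulOpposite.smul_eq_mul_unop,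
    MulOpposite.unop_op]
  ring

theorem bfgsUpdate_isHermitian {H : RMat n} (hH : H.IsHermitian) (y z : RVec n) :
    (bfgsUpdate H y z).IsHermitian := by
  have hT : H.transpose = H := by simpa using hH.eq
  have : (bfgsUpdate H y z).transpose = bfgsUpdate H y z := by
    simp [bfgsUpdate, Matrix.transpose_vecMulVec, hT]
  simpa [Matrix.IsHermitian] using this

theorem bfgsUpdate_zero (H : RMat n) : bfgsUpdate H 0 0 = H := by
  simp [bfgsUpdate]

theorem bfgsUpdate_secant {H : RMat n} {y z : RVec n} (hyz : inner ℝ y z ≠ 0)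
    (hz : inner ℝ z (matVec H z) ≠ 0) : matVec (bfgsUpdate H y z) z = y := by
  rw [matVec_bfgsUpdate, div_self hyz, real_inner_comm, div_self hz]
  simp

/-- Completing the square, the new quadratic form at v is the H-form at v - t z, with t z the
H-projection of v onto z, plus ⟨y, v⟩² / ⟨y, z⟩. If the first term vanishes then v is a nonzero
multiple of z, and the second is positive. -/
theorem bfgsUpdate_posDef {H : RMat n} (hH : H.PosDef) {y z : RVec n} (hyz : 0 < inner ℝ y z) :
    (bfgsUpdate H y z).PosDef := by
  have hz0 : z ≠ 0 := by
    rintro rfl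
    simp at hyz
  have hz := inner_matVec_pos hH hz0
  refine posDef_of_inner_matVec_pos (bfgsUpdate_isHermitian hH.isHermitian y z) fun v hv => ?_
  have key : inner ℝ v (matVec (bfgsUpdate H y z) v) =
      inner ℝ v (matVec H v) - inner ℝ v (matVec H z) ^ 2 / inner ℝ z (matVec H z)
        + inner ℝ y v ^ 2 / inner ℝ y z := by
    rw [matVec_bfgsUpdate, inner_sub_right, inner_add_right, real_inner_smul_right,
      real_inner_smul_right, real_inner_comm v (matVec H z), real_inner_comm v y]
    ring
  rw [key]
  set t := inner ℝ v (matVec H z) / inner ℝ z (matVec H z) with ht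
  have hsq := inner_matVec_smul_sub hH.isHermitian v z 1 t
  have h1 : inner ℝ v (matVec H v) - inner ℝ v (matVec H z) ^ 2 / inner ℝ z (matVec H z) =
      inner ℝ ((1 : ℝ) • v - t • z) (matVec H ((1 : ℝ) • v - t • z)) := by
    rw [hsq, ht]
    field_simp
    ring
  rw [h1]
  by_cases hvz : (1 : ℝ) • v - t • z = 0
  · have hvt : v = t • z := by simpa [sub_eq_zero] using hvz
    have ht0 : t ≠ 0 := fun h => hv (by rw [hvt, h, zero_smul])
    have : inner ℝ y v = t * inner ℝ y z := by
      rw [hvt, real_inner_smul_right]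
    rw [hvz, this]
    simp only [matVec_zero, inner_zero_left, zero_add]
    positivity
  · have := inner_matVec_pos hH hvz
    positivity

theorem trace_inv_mul_vecMulVec (G : RMat n) (y : RVec n) :
    (G⁻¹ * Matrix.vecMulVec y.ofLp y.ofLp).trace = inner ℝ y (matVec G⁻¹ y) := by
  rw [Matrix.mul_vecMulVec, Matrix.trace_vecMulVec, inner_matVec, dotProduct_comm]

theorem trace_inv_mul_bfgsUpdate (G H : RMat n) (y z : RVec n) :
    (G⁻¹ * bfgsUpdate H y z).trace = (G⁻¹ * H).trace
      + inner ℝ y (matVec G⁻¹ y) / inner ℝ y z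
      - inner ℝ (matVec H z) (matVec G⁻¹ (matVec H z)) / inner ℝ z (matVec H z) := by
  rw [← trace_inv_mul_vecMulVec, ← trace_inv_mul_vecMulVec, bfgsUpdate, Matrix.mul_sub,
    Matrix.mul_add, Matrix.trace_sub, Matrix.trace_add, Matrix.mul_smul, Matrix.mul_smul,
    Matrix.trace_smul, Matrix.trace_smul, smul_eq_mul, smul_eq_mul]
  ring

/-- The update factors as H(1 + UV) with U of width 2, and det(1 + UV) = det(1 + VU) reduces to a
2×2 determinant. The lower right entry of 1 + VU is 0, so only the off-diagonal product survives. -/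
theorem det_bfgsUpdate {H : RMat n} (hH : H.PosDef) {y z : RVec n} (hyz : inner ℝ y z ≠ 0)
    (hz : inner ℝ z (matVec H z) ≠ 0) :
    (bfgsUpdate H y z).det = H.det * (inner ℝ y z / inner ℝ z (matVec H z)) := by
  set U : Matrix (Fin n) (Fin 2) ℝ :=
    Matrix.of fun i j => ![(matVec H⁻¹ y).ofLp i, z.ofLp i] j with hU
  set V : Matrix (Fin 2) (Fin n) ℝ :=
    Matrix.of ![(inner ℝ y z)⁻¹ • y.ofLp, -(inner ℝ z (matVec H z))⁻¹ • (matVec H z).ofLp] with hV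
  have hHU : H * U = Matrix.of fun i j => ![y.ofLp i, (matVec H z).ofLp i] j := by
    ext i j
    fin_cases j
    · have := congrArg (fun v : RVec n => v.ofLp i) (matVec_matVec_inv hH y)
      exact this
    · simp [Matrix.mul_apply, hU, matVec, Matrix.mulVec, dotProduct]
  have hfac : bfgsUpdate H y z = H * (1 + U * V) := by
    rw [Matrix.mul_add, Matrix.mul_one, ← Matrix.mul_assoc, hHU]
    ext i j
    simp [bfgsUpdate, Matrix.mul_apply, Fin.sum_univ_two, hV, Matrix.vecMulVec_apply]
    ring
  have hz' : inner ℝ (matVec H z) (matVec H⁻¹ y) = inner ℝ y z := by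
    rw [inner_matVec_comm hH.inv.isHermitian, matVec_inv_matVec hH]
  rw [inner_eq_dotProduct] at hz'
  have e00 : (V * U) 0 0 = (inner ℝ y z)⁻¹ * inner ℝ y (matVec H⁻¹ y) := by
    simp [Matrix.mul_apply, hU, hV, inner_eq_dotProduct, dotProduct, Finset.mul_sum, mul_assoc]
  have e01 : (V * U) 0 1 = 1 := by
    calc (V * U) 0 1 = (inner ℝ y z)⁻¹ * (y.ofLp ⬝ᵥ z.ofLp) := by
          simp [Matrix.mul_apply, hU, hV, dotProduct, Finset.mul_sum, mul_assoc]
      _ = 1 := by rw [← inner_eq_dotProduct, inv_mul_cancel₀ hyz]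
  have e10 : (V * U) 1 0 = -(inner ℝ z (matVec H z))⁻¹ * inner ℝ y z := by
    rw [← hz']
    simp [Matrix.mul_apply, hU, hV, dotProduct, Finset.mul_sum, mul_assoc]
  have e11 : (V * U) 1 1 = -1 := by
    calc (V * U) 1 1 = -((inner ℝ z (matVec H z))⁻¹ * ((matVec H z).ofLp ⬝ᵥ z.ofLp)) := by
          simp [Matrix.mul_apply, hU, hV, dotProduct, Finset.mul_sum, mul_assoc]
      _ = -1 := by rw [← inner_eq_dotProduct, real_inner_comm z (matVec H z), inv_mul_cancel₀ hz]
  rw [hfac, Matrix.det_mul, Matrix.det_one_add_mul_comm, Matrix.det_fin_two]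
  simp only [Matrix.add_apply, Matrix.one_apply_eq, e00, e01, e10, e11]
  simp
  left
  field_simp

end Matrices

/-! ### The Byrd–Nocedal potential and the Dennis–Moré property of BFGS. -/

section BFGSPotential

variable {n : ℕ}

theorem log_det_le_trace {B : RMat n} (hB : B.PosDef) : Real.log B.det ≤ B.trace := by
  rw [hB.isHermitian.det_eq_prod_eigenvalues, hB.isHermitian.trace_eq_sum_eigenvalues]
  simp only [RCLike.ofReal_real_eq_id, id_eq]
  rw [Real.log_prod fun i _ => (hB.eigenvalues_pos i).ne']
  refine Finset.sum_le_sum fun i _ => ?_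
  linarith [Real.log_le_sub_one_of_pos (hB.eigenvalues_pos i)]

/-- The potential `tr (G⁻¹ H) - log det H` of Byrd and Nocedal, relative to the metric `G`. -/
noncomputable def bfgsPotential (G H : RMat n) : ℝ :=
  (G⁻¹ * H).trace - Real.log H.det

open scoped MatrixOrder in
-- With G⁻¹ = RᵀR, the matrix R H Rᵀ is positive definite, has trace tr(G⁻¹H) and determinant (det
-- R)² det H. The eigenvalue bound log λ ≤ λ therefore bounds the potential below by log (det R)².
theorem exists_le_bfgsPotential {G : RMat n} (hG : G.PosDef) :
    ∃ C : ℝ, ∀ H : RMat n, H.PosDef → C ≤ bfgsPotential G H := by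
  obtain ⟨R, hR⟩ := CStarAlgebra.nonneg_iff_eq_star_mul_self.mp hG.inv.posSemidef.nonneg
  rw [Matrix.star_eq_conjTranspose] at hR
  have hdet : R.det ≠ 0 := by
    intro h
    have := hG.inv.det_pos
    rw [hR, Matrix.det_mul, h] at this
    simp at this
  have hinj : Function.Injective R.conjTranspose.mulVec := by
    rw [Matrix.mulVec_injective_iff_isUnit, Matrix.isUnit_iff_isUnit_det]
    simpa using hdet
  refine ⟨Real.log (R.det ^ 2), fun H hH => ?_⟩
  have hB : (R * H * R.conjTranspose).PosDef := by
    have := hH.conjTranspose_mul_mul_same hinj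
    simpa using this
  have h1 := log_det_le_trace hB
  have h2 : (R * H * R.conjTranspose).det = R.det ^ 2 * H.det := by
    rw [Matrix.det_mul, Matrix.det_mul, Matrix.det_conjTranspose]
    simp
    ring
  rw [h2, Real.log_mul (pow_ne_zero 2 hdet) hH.det_pos.ne', Matrix.trace_mul_comm,
    ← Matrix.mul_assoc, ← hR] at h1
  unfold bfgsPotential
  linarith

theorem abs_sqrt_sub_one_le {q c : ℝ} (hq : 0 < q) (h : q - 1 - Real.log q ≤ c) :
    |√q - 1| ≤ √c := by
  have hs : 0 < √q := Real.sqrt_pos.2 hq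
  have h1 : Real.log q = 2 * Real.log √q := by
    rw [Real.log_sqrt hq.le]
    ring
  have h2 := Real.log_le_sub_one_of_pos hs
  refine Real.abs_le_sqrt ?_
  nlinarith [Real.sq_sqrt hq.le]

/-- The left side equals (a - q)q + (q - 1)². Since c dominates (a - q) + (q - 1 - log q), a sum of
nonnegative terms, it dominates each of them; the second one controls √q - 1. The bound tends to 0
with c, which is all that is needed. -/
theorem mul_sub_two_mul_add_one_le {a q c : ℝ} (hq : 0 < q) (haq : q ≤ a)
    (h : a - 1 - Real.log q ≤ c) :
    a * q - 2 * q + 1 ≤ c * (1 + √c) ^ 2 + c * (2 + √c) ^ 2 := by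
  have hlog := Real.log_le_sub_one_of_pos hq
  have hc : 0 ≤ c := by linarith
  have h1 := abs_sqrt_sub_one_le hq (show q - 1 - Real.log q ≤ c by linarith)
  have hs := Real.sqrt_nonneg c
  have hq0 := Real.sqrt_nonneg q
  have hqs := Real.sq_sqrt hq.le
  have h2 : √q ≤ 1 + √c := by linarith [(abs_le.1 h1).2]
  have h3 : q ≤ (1 + √c) ^ 2 := by
    rw [← hqs]
    gcongr
  have h4 : (q - 1) ^ 2 ≤ c * (2 + √c) ^ 2 := by
    have : (q - 1) ^ 2 = (√q - 1) ^ 2 * (√q + 1) ^ 2 := by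
      rw [← mul_pow]
      congr 1
      linarith
    rw [this]
    have h5 : (√q - 1) ^ 2 ≤ c := by
      rw [← Real.sq_sqrt hc]
      exact sq_le_sq.2 (by rwa [abs_of_nonneg hs])
    have h6 : (√q + 1) ^ 2 ≤ (2 + √c) ^ 2 := by
      gcongr ?_ ^ 2
      linarith
    gcongr
  have h5 : (a - q) * q ≤ c * (1 + √c) ^ 2 := by
    gcongr
    linarith
  nlinarith

/-- By log s ≥ 1 - 1/s the left side is at most e² / (1 + t), of second order in e. The constant 5
is generous; any bound linear in e is enough for summability. -/
theorem sub_one_sub_log_le {t e : ℝ} (he : e ≤ 1 / 2) (ht : |t| ≤ e) :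
    (1 + 2 * t + e ^ 2) / (1 + t) - 1 - Real.log (1 + t) ≤ 5 * e := by
  have he0 : 0 ≤ e := (abs_nonneg t).trans ht
  obtain ⟨h1, h2⟩ := abs_le.1 ht
  have hpos : 0 < 1 + t := by linarith
  have h3 := Real.one_sub_inv_le_log_of_pos hpos
  have h4 : (1 + 2 * t + e ^ 2) / (1 + t) - 1 + ((1 + t)⁻¹ - 1) ≤ 5 * e := by
    have : (1 + 2 * t + e ^ 2) / (1 + t) - 1 + ((1 + t)⁻¹ - 1) = e ^ 2 / (1 + t) := by
      field_simp
      ring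
    rw [this, div_le_iff₀ hpos]
    nlinarith
  linarith

theorem inner_matVec_sub_inv {G : RMat n} (hG : G.PosDef) (u z : RVec n) :
    inner ℝ (u - matVec G z) (matVec G⁻¹ (u - matVec G z)) =
      inner ℝ u (matVec G⁻¹ u) - 2 * inner ℝ u z + inner ℝ z (matVec G z) := by
  rw [matVec_sub, matVec_inv_matVec hG]
  simp only [inner_sub_left, inner_sub_right]
  rw [inner_matVec_comm hG.inv.isHermitian (matVec G z) u, matVec_inv_matVec hG,
    real_inner_comm z (matVec G z)]
  ring

/-- One BFGS step decreases the potential, up to the secant error, by an amount `c` which controls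
the Dennis–Moré quotient. -/
theorem bfgsPotential_step {G H : RMat n} (hG : G.PosDef) (hH : H.PosDef) {y z : RVec n}
    (hz : z ≠ 0) (hyz : 0 < inner ℝ y z) {e : ℝ} (he : e ≤ 1 / 2) (he0 : 0 ≤ e)
    (hyG : weightedNorm G⁻¹ (y - matVec G z) ≤ e * weightedNorm G z) :
    ∃ c : ℝ, 0 ≤ c ∧ bfgsPotential G (bfgsUpdate H y z) + c ≤ bfgsPotential G H + 5 * e ∧
      (weightedNorm G⁻¹ (matVec (H - G) z) / weightedNorm G z) ^ 2 ≤
        c * (1 + √c) ^ 2 + c * (2 + √c) ^ 2 := by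
  have hzG := inner_matVec_pos hG hz
  have hzH := inner_matVec_pos hH hz
  set g := inner ℝ z (matVec G z) with hg
  set h := inner ℝ z (matVec H z) with hh
  set w := inner ℝ (matVec H z) (matVec G⁻¹ (matVec H z)) with hw
  set Y := inner ℝ y (matVec G⁻¹ y) with hY
  set a := w / h with ha
  set q := h / g with hq
  have hqpos : 0 < q := div_pos hzH hzG
  have hCS : h ^ 2 ≤ w * g := by
    have := inner_sq_le_inv hG (matVec H z) z
    rwa [real_inner_comm] at this
  have haq : q ≤ a := by
    rw [hq, ha, div_le_div_iff₀ hzG hzH]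
    nlinarith
  -- The terms of the potential change that involve H are -a + log q. Adding and subtracting 1 makes
  -- c nonnegative, because a ≥ q, and leaves Y / ⟨y, z⟩ - 1 - log (1 + t) as the secant error.
  refine ⟨a - 1 - Real.log q, ?_, ?_, ?_⟩
  · linarith [Real.log_le_sub_one_of_pos hqpos]
  · set t := inner ℝ (y - matVec G z) z / g with ht
    have hE : inner ℝ (y - matVec G z) (matVec G⁻¹ (y - matVec G z)) ≤ e ^ 2 * g := by
      rw [← weightedNorm_sq hG.inv, hg, ← weightedNorm_sq hG, ← mul_pow]
      exact pow_le_pow_left₀ (Real.sqrt_nonneg _) hyG 2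
    have hte : |t| ≤ e := by
      refine abs_le_of_sq_le_sq ?_ he0
      have h1 := inner_sq_le_inv hG (y - matVec G z) z
      rw [ht, div_pow, div_le_iff₀ (by positivity)]
      calc _ ≤ _ := h1
        _ ≤ (e ^ 2 * g) * g := by gcongr
        _ = e ^ 2 * g ^ 2 := by ring
    have hyzg : inner ℝ y z = g * (1 + t) := by
      rw [ht, inner_sub_left, real_inner_comm z (matVec G z), ← hg]
      field_simp
      ring
    have ht1 : 0 < 1 + t := by
      rw [hyzg] at hyz
      exact (mul_pos_iff_of_pos_left hzG).1 hyz
    have hYle : Y ≤ g * (1 + 2 * t + e ^ 2) := by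
      rw [inner_matVec_sub_inv hG, ← hg, ← hY, hyzg] at hE
      nlinarith
    have hM : Y / inner ℝ y z ≤ (1 + 2 * t + e ^ 2) / (1 + t) := by
      rw [hyzg, div_le_div_iff₀ (by positivity) ht1]
      nlinarith
    have hlog : Real.log (H.det * (inner ℝ y z / h)) =
        Real.log H.det + Real.log (1 + t) - Real.log q := by
      have : inner ℝ y z / h = (1 + t) / q := by
        rw [hyzg, hq]
        field_simp
      rw [this, Real.log_mul hH.det_pos.ne' (by positivity), Real.log_div ht1.ne' hqpos.ne']
      ring
    unfold bfgsPotential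
    rw [trace_inv_mul_bfgsUpdate, det_bfgsUpdate hH hyz.ne' hzH.ne', ← hY, ← hw, ← hh, ← ha, hlog]
    have := sub_one_sub_log_le he hte
    linarith
  · have hquot : (weightedNorm G⁻¹ (matVec (H - G) z) / weightedNorm G z) ^ 2 =
        a * q - 2 * q + 1 := by
      rw [div_pow, weightedNorm_sq hG.inv, weightedNorm_sq hG, sub_matVec,
        inner_matVec_sub_inv hG, real_inner_comm z (matVec H z), ← hh, ← hw, ← hg, ha, hq]
      field_simp
    rw [hquot]
    exact mul_sub_two_mul_add_one_le hqpos haq le_rfl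

open Filter Topology in
/-- Bounded deterioration with summable errors implies that the decrements tend to zero. -/
theorem tendsto_zero_of_add_le {p c e : ℕ → ℝ} {C : ℝ} (hp : ∀ k, C ≤ p k) (hc : ∀ k, 0 ≤ c k)
    (he0 : ∀ k, 0 ≤ e k) (he : Summable e) (h : ∀ k, p (k + 1) + c k ≤ p k + e k) :
    Tendsto c atTop (𝓝 0) := by
  refine (summable_of_sum_range_le (c := p 0 - C + ∑' k, e k) hc fun N => ?_).tendsto_atTop_zero
  have h1 : ∀ N, ∑ k ∈ Finset.range N, c k ≤ p 0 - p N + ∑ k ∈ Finset.range N, e k := by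
    intro N
    induction N with
    | zero => simp
    | succ N ih =>
      rw [Finset.sum_range_succ, Finset.sum_range_succ]
      linarith [h N]
  linarith [h1 N, hp N, he.sum_le_tsum (Finset.range N) fun k _ => he0 k]

open Filter Topology in
/-- The Dennis–Moré property of BFGS matrices under summable secant errors. -/
theorem tendsto_dennisMore_of_bfgs {G : RMat n} (hG : G.PosDef) {H : ℕ → RMat n}
    {y z : ℕ → RVec n} {e : ℕ → ℝ} (hH : ∀ k, (H k).PosDef)
    (hupd : ∀ k, H (k + 1) = bfgsUpdate (H k) (y k) (z k))
    (hyz : ∀ k, z k ≠ 0 → 0 < inner ℝ (y k) (z k)) (hy0 : ∀ k, z k = 0 → y k = 0)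
    (he0 : ∀ k, 0 ≤ e k) (he : Summable e)
    (hsec : ∀ᶠ k in atTop, weightedNorm G⁻¹ (y k - matVec G (z k)) ≤ e k * weightedNorm G (z k)) :
    Tendsto (fun k => weightedNorm G⁻¹ (matVec (H k - G) (z k)) / weightedNorm G (z k))
      atTop (𝓝 0) := by
  have hhalf : ∀ᶠ k in atTop, e k ≤ 1 / 2 :=
    (he.tendsto_atTop_zero.eventually (gt_mem_nhds (by norm_num : (0 : ℝ) < 1 / 2))).mono
      fun k hk => hk.le
  obtain ⟨N, hN⟩ := eventually_atTop.1 (hsec.and hhalf)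
  obtain ⟨C, hC⟩ := exists_le_bfgsPotential hG
  have hstep : ∀ k, ∃ c : ℝ, 0 ≤ c ∧
      bfgsPotential G (H (k + 1 + N)) + c ≤ bfgsPotential G (H (k + N)) + 5 * e (k + N) ∧
      (weightedNorm G⁻¹ (matVec (H (k + N) - G) (z (k + N))) / weightedNorm G (z (k + N))) ^ 2 ≤
        c * (1 + √c) ^ 2 + c * (2 + √c) ^ 2 := by
    intro k
    obtain ⟨h1, h2⟩ := hN (k + N) (Nat.le_add_left N k)
    rw [show k + 1 + N = k + N + 1 by ring, hupd]
    -- At a zero step the matrix is kept and the quotient is 0/0 = 0, so c = 0 works.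
    by_cases hz : z (k + N) = 0
    · refine ⟨0, le_rfl, ?_, ?_⟩
      · rw [hz, hy0 _ hz, bfgsUpdate_zero]
        linarith [he0 (k + N)]
      · simp [hz, weightedNorm]
    · exact bfgsPotential_step hG (hH _) hz (hyz _ hz) h2 (he0 _) h1
  choose c hc0 hc1 hc2 using hstep
  have hc : Tendsto c atTop (𝓝 0) :=
    tendsto_zero_of_add_le (p := fun k => bfgsPotential G (H (k + N)))
      (e := fun k => 5 * e (k + N)) (fun k => hC _ (hH _)) hc0
      (fun k => mul_nonneg (by norm_num) (he0 _))
      (((summable_nat_add_iff N).2 he).mul_left 5) hc1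
  have hΦ : Continuous fun c : ℝ => c * (1 + √c) ^ 2 + c * (2 + √c) ^ 2 := by fun_prop
  have hlim : Tendsto (fun k => c k * (1 + √(c k)) ^ 2 + c k * (2 + √(c k)) ^ 2) atTop (𝓝 0) := by
    have := (hΦ.tendsto 0).comp hc
    simpa [Function.comp_def] using this
  rw [← tendsto_add_atTop_iff_nat N]
  have hsq := squeeze_zero (fun k => sq_nonneg _) hc2 hlim
  have hs := (Real.continuous_sqrt.tendsto 0).comp hsq
  rw [Real.sqrt_zero] at hs
  refine hs.congr fun k => ?_
  simp only [Function.comp_apply]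
  exact Real.sqrt_sq (div_nonneg (Real.sqrt_nonneg _) (Real.sqrt_nonneg _))

end BFGSPotential

/-! ### Convex functions along lines and a trilinear polarization bound. -/

section ConvexDifferentiable

open Set Filter Topology

variable {E : Type*} [NormedAddCommGroup E] [NormedSpace ℝ E]

theorem hasDerivAt_comp_line {F : Type*} [NormedAddCommGroup F] [NormedSpace ℝ F] {Φ : E → F}
    {x v : E} {t : ℝ} (h : DifferentiableAt ℝ Φ (x + t • v)) :
    HasDerivAt (fun s : ℝ => Φ (x + s • v)) (fderiv ℝ Φ (x + t • v) v) t := by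
  have h1 : HasDerivAt (fun s : ℝ => x + s • v) v t := by
    simpa using ((hasDerivAt_id t).smul_const v).const_add x
  exact h.hasFDerivAt.comp_hasDerivAt t h1

theorem convexOn_comp_line {D : Set E} {Φ : E → ℝ} (h : ConvexOn ℝ D Φ) (x v : E) :
    ConvexOn ℝ {t : ℝ | x + t • v ∈ D} (fun t : ℝ => Φ (x + t • v)) := by
  have := h.comp_affineMap (AffineMap.lineMap x (x + v) : ℝ →ᵃ[ℝ] E)
  have e : (fun t : ℝ => (AffineMap.lineMap x (x + v) : ℝ →ᵃ[ℝ] E) t) = fun t => x + t • v := by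
    funext t
    simp [AffineMap.lineMap_apply, add_comm]
  have e2 : (AffineMap.lineMap x (x + v) : ℝ → E) = fun t => x + t • v := e
  rw [e2] at this
  exact this

theorem ConvexOn.add_fderiv_le {D : Set E} {Φ : E → ℝ} (h : ConvexOn ℝ D Φ) {x u : E} (hx : x ∈ D)
    (hu : u ∈ D) (hd : DifferentiableAt ℝ Φ x) : Φ x + fderiv ℝ Φ x (u - x) ≤ Φ u := by
  have h1 := convexOn_comp_line h x (u - x)
  have h2 : HasDerivAt (fun s : ℝ => Φ (x + s • (u - x))) (fderiv ℝ Φ x (u - x)) 0 := by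
    have := hasDerivAt_comp_line (Φ := Φ) (x := x) (v := u - x) (t := 0) (by simpa using hd)
    simpa using this
  have h3 := h1.le_slope_of_hasDerivAt (x := 0) (y := 1) (by simpa using hx) (by simpa using hu)
    one_pos h2
  simp only [slope_def_field, one_smul, zero_smul, add_zero, add_sub_cancel] at h3
  linarith

theorem convexOn_monotoneOn_fderiv_line {D : Set E} {Φ : E → ℝ} (h : ConvexOn ℝ D Φ)
    (hd : ∀ x ∈ D, DifferentiableAt ℝ Φ x) (x v : E) :
    MonotoneOn (fun t : ℝ => fderiv ℝ Φ (x + t • v) v) {t : ℝ | x + t • v ∈ D} := by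
  have h1 := convexOn_comp_line h x v
  have h2 : ∀ t ∈ {t : ℝ | x + t • v ∈ D},
      HasDerivAt (fun s : ℝ => Φ (x + s • v)) (fderiv ℝ Φ (x + t • v) v) t :=
    fun t ht => hasDerivAt_comp_line (hd _ ht)
  have h3 := h1.monotoneOn_deriv fun t ht => (h2 t ht).differentiableAt
  intro s hs t ht hst
  have := h3 hs ht hst
  rwa [(h2 s hs).deriv, (h2 t ht).deriv] at this

theorem hasDerivAt_fderiv_line {Φ : E → ℝ} {x v : E} {t : ℝ} (w : E)
    (hd : DifferentiableAt ℝ (fderiv ℝ Φ) (x + t • v)) :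
    HasDerivAt (fun s : ℝ => fderiv ℝ Φ (x + s • v) w)
      (fderiv ℝ (fderiv ℝ Φ) (x + t • v) v w) t := by
  simpa using (hasDerivAt_comp_line hd).clm_apply (hasDerivAt_const t w)

theorem convexOn_second_fderiv_nonneg {D : Set E} (hD : IsOpen D) {Φ : E → ℝ}
    (h : ConvexOn ℝ D Φ) (hd : ∀ x ∈ D, DifferentiableAt ℝ Φ x) {x : E} (hx : x ∈ D)
    (hd2 : DifferentiableAt ℝ (fderiv ℝ Φ) x) (v : E) :
    0 ≤ fderiv ℝ (fderiv ℝ Φ) x v v := by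
  have hm := convexOn_monotoneOn_fderiv_line h hd x v
  have h1 : HasDerivAt (fun s : ℝ => fderiv ℝ Φ (x + s • v) v)
      (fderiv ℝ (fderiv ℝ Φ) x v v) 0 := by
    have := hasDerivAt_fderiv_line (Φ := Φ) (x := x) (v := v) (t := 0) v (by simpa using hd2)
    simpa using this
  have hopen : {t : ℝ | x + t • v ∈ D} ∈ 𝓝 (0 : ℝ) := by
    refine (hD.preimage (by fun_prop : Continuous fun t : ℝ => x + t • v)).mem_nhds ?_
    simpa using hx
  have h2 := (hasDerivAt_iff_tendsto_slope.1 h1).mono_left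
    (nhdsWithin_mono (0 : ℝ) (fun t ht => (ne_of_gt ht) : Ioi (0 : ℝ) ⊆ {0}ᶜ))
  refine ge_of_tendsto h2 ?_
  filter_upwards [nhdsWithin_le_nhds hopen, self_mem_nhdsWithin] with t ht ht0
  rw [slope_def_field]
  refine div_nonneg (sub_nonneg.2 (hm ?_ ht (le_of_lt ht0))) (by simpa using le_of_lt ht0)
  simpa using hx

/-- The slope along z is monotone on the segment; if it does not increase from one end to the other
it is constant, so its one-sided derivative at the start vanishes. -/
theorem convexOn_second_fderiv_eq_zero {D : Set E} {Φ : E → ℝ}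
    (h : ConvexOn ℝ D Φ) (hd : ∀ x ∈ D, DifferentiableAt ℝ Φ x) {x z : E} (hx : x ∈ D)
    (hxz : x + z ∈ D) (hd2 : DifferentiableAt ℝ (fderiv ℝ Φ) x)
    (h0 : fderiv ℝ Φ (x + z) z ≤ fderiv ℝ Φ x z) :
    fderiv ℝ (fderiv ℝ Φ) x z z = 0 := by
  have hm := convexOn_monotoneOn_fderiv_line h hd x z
  have h1 : HasDerivAt (fun s : ℝ => fderiv ℝ Φ (x + s • z) z)
      (fderiv ℝ (fderiv ℝ Φ) x z z) 0 := by
    have := hasDerivAt_fderiv_line (Φ := Φ) (x := x) (v := z) (t := 0) z (by simpa using hd2)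
    simpa using this
  have hmem : ∀ t ∈ Icc (0 : ℝ) 1, x + t • z ∈ D := fun t ht => by
    have := h.1.add_smul_sub_mem hx hxz ht
    simpa using this
  have hconst : ∀ t ∈ Icc (0 : ℝ) 1, fderiv ℝ Φ (x + t • z) z = fderiv ℝ Φ x z := by
    intro t ht
    have a1 := hm (by simpa using hx) (hmem t ht) ht.1
    have a2 := hm (hmem t ht) (by simpa using hxz) ht.2
    simp only [zero_smul, add_zero, one_smul] at a1 a2
    linarith
  have h2 : HasDerivWithinAt (fun s : ℝ => fderiv ℝ Φ (x + s • z) z) 0 (Icc 0 1) 0 :=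
    (hasDerivWithinAt_const (0 : ℝ) (Icc 0 1) (fderiv ℝ Φ x z)).congr hconst (by simp)
  exact (uniqueDiffOn_Icc one_pos 0 (by simp)).eq_deriv _ h1.hasDerivWithinAt h2

/-- A symmetric trilinear form controlled on the diagonal by a positive semidefinite quadratic form
is controlled off the diagonal. -/
theorem abs_trilinear_le (T : E →L[ℝ] E →L[ℝ] E →L[ℝ] ℝ) (A : E →L[ℝ] E →L[ℝ] ℝ)
    (hT1 : ∀ a b c, T a b c = T b a c) (hT2 : ∀ a b c, T a b c = T a c b)
    (hA : ∀ v, 0 ≤ A v v) (hTA : ∀ v, |T v v v| ≤ 2 * (A v v) ^ ((3 : ℝ) / 2))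
    {M : ℝ} {u : E} (hM : A u u ≤ M) (z : E) :
    |T u z z| ≤ 2 * (2 * M + 2) ^ ((3 : ℝ) / 2) * A z z := by
  have hM0 : 0 ≤ M := (hA u).trans hM
  set K := (2 * M + 2) ^ ((3 : ℝ) / 2) with hK
  have hK0 : 0 ≤ K := by positivity
  -- Polarization expresses 6 T(u,w,w) through the cubes at u + w, u - w and u, and the
  -- parallelogram law bounds the A-form at u ± w by 2M + 2. The general z is reached by scaling.
  have hunit : ∀ w, A w w ≤ 1 → |T u w w| ≤ 2 * K := by
    intro w hw
    have hpar : A (u + w) (u + w) + A (u - w) (u - w) = 2 * A u u + 2 * A w w := by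
      simp only [map_add, map_sub, add_apply, sub_apply]
      ring
    have hb : ∀ v, A v v ≤ 2 * M + 2 → |T v v v| ≤ 2 * K := fun v hv =>
      (hTA v).trans (by
        rw [hK]
        gcongr
        exact hA v)
    have b1 := abs_le.1 (hb (u + w) (by linarith [hA (u - w)]))
    have b2 := abs_le.1 (hb (u - w) (by linarith [hA (u + w)]))
    have b3 := abs_le.1 (hb u (by linarith))
    have hpol : 6 * T u w w = T (u + w) (u + w) (u + w) + T (u - w) (u - w) (u - w)
        - 2 * T u u u := by
      simp only [map_add, map_sub, add_apply, sub_apply]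
      rw [hT1 w u w, hT2 w w u, hT1 w u w]
      ring
    rw [abs_le]
    constructor <;> linarith [b1.1, b1.2, b2.1, b2.2, b3.1, b3.2]
  have hscale : ∀ l : ℝ, l ^ 2 * A z z ≤ 1 → l ^ 2 * |T u z z| ≤ 2 * K := by
    intro l hl
    have e1 : A (l • z) (l • z) = l ^ 2 * A z z := by
      simp only [map_smul, smul_apply, smul_eq_mul]
      ring
    have e2 : T u (l • z) (l • z) = l ^ 2 * T u z z := by
      simp only [map_smul, smul_apply, smul_eq_mul]
      ring
    have := hunit (l • z) (by rwa [e1])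
    rwa [e2, abs_mul, abs_of_nonneg (sq_nonneg l)] at this
  rcases (hA z).eq_or_lt with hz | hz
  · rw [← hz, mul_zero]
    -- Here A z z = 0, so arbitrarily large multiples of z are admissible; this factor gives 2K + 1
    -- ≤ 2K.
    by_contra! hpos
    have h1 := hscale √((2 * K + 1) / |T u z z|) (by rw [← hz]; simp)
    rw [Real.sq_sqrt (by positivity), div_mul_cancel₀ _ hpos.ne'] at h1
    linarith
  · have h1 := hscale (√(A z z))⁻¹ (by
      rw [inv_pow, Real.sq_sqrt hz.le, inv_mul_cancel₀ hz.ne'])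
    rw [inv_pow, Real.sq_sqrt hz.le, inv_mul_le_iff₀ hz] at h1
    linarith

end ConvexDifferentiable

/-! ### Self-concordance: constancy of the Hessian kernel and strict monotonicity of the gradient.
-/

section SelfConcordant

open Set Filter Topology

variable {E : Type*} [NormedAddCommGroup E] [NormedSpace ℝ E] {D : Set E} {Φ : E → ℝ}

theorem contDiffAt_fderivs (hD : IsOpen D) (hΦ : ContDiffOn ℝ 3 Φ D) {x : E} (hx : x ∈ D) :
    ContDiffAt ℝ 3 Φ x ∧ ContDiffAt ℝ 2 (fderiv ℝ Φ) x ∧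
      ContDiffAt ℝ 1 (fderiv ℝ (fderiv ℝ Φ)) x := by
  have h0 : ContDiffAt ℝ 3 Φ x := hΦ.contDiffAt (hD.mem_nhds hx)
  have h1 : ContDiffAt ℝ 2 (fderiv ℝ Φ) x := h0.fderiv_right (by norm_num)
  exact ⟨h0, h1, h1.fderiv_right (by norm_num)⟩

/-- Symmetry of the second derivative holds on a neighbourhood of x and can be differentiated there.
-/
theorem third_fderiv_symm_right (hD : IsOpen D) (hΦ : ContDiffOn ℝ 3 Φ D) {x : E} (hx : x ∈ D)
    (a b c : E) :
    fderiv ℝ (fderiv ℝ (fderiv ℝ Φ)) x a b c = fderiv ℝ (fderiv ℝ (fderiv ℝ Φ)) x a c b := by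
  have hd : DifferentiableAt ℝ (fderiv ℝ (fderiv ℝ Φ)) x :=
    (contDiffAt_fderivs hD hΦ hx).2.2.differentiableAt (by norm_num)
  have key : ∀ p q : E, HasFDerivAt (fun y => fderiv ℝ (fderiv ℝ Φ) y p q)
      (((fderiv ℝ (fderiv ℝ (fderiv ℝ Φ)) x).flip p).flip q) x := fun p q => by
    have := (hd.hasFDerivAt.clm_apply (hasFDerivAt_const p x)).clm_apply (hasFDerivAt_const q x)
    simpa using this
  have heq : (fun y => fderiv ℝ (fderiv ℝ Φ) y b c) =ᶠ[𝓝 x]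
      fun y => fderiv ℝ (fderiv ℝ Φ) y c b := by
    filter_upwards [hD.mem_nhds hx] with y hy
    exact ((contDiffAt_fderivs hD hΦ hy).1.isSymmSndFDerivAt (by simp; norm_num)) b c
  have := (key b c).unique ((key c b).congr_of_eventuallyEq heq)
  simpa using congrArg (fun L : E →L[ℝ] ℝ => L a) this

theorem third_fderiv_symm_left (hD : IsOpen D) (hΦ : ContDiffOn ℝ 3 Φ D) {x : E} (hx : x ∈ D)
    (a b c : E) :
    fderiv ℝ (fderiv ℝ (fderiv ℝ Φ)) x a b c = fderiv ℝ (fderiv ℝ (fderiv ℝ Φ)) x b a c := by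
  have := ((contDiffAt_fderivs hD hΦ hx).2.1.isSymmSndFDerivAt (by simp)) a b
  rw [this]

theorem iteratedDeriv_line (hD : IsOpen D) (hΦ : ContDiffOn ℝ 3 Φ D) (x v : E) :
    (∀ t : ℝ, x + t • v ∈ D → iteratedDeriv 2 (fun s : ℝ => Φ (x + s • v)) t =
      fderiv ℝ (fderiv ℝ Φ) (x + t • v) v v) ∧
    (∀ t : ℝ, x + t • v ∈ D → iteratedDeriv 3 (fun s : ℝ => Φ (x + s • v)) t =
      fderiv ℝ (fderiv ℝ (fderiv ℝ Φ)) (x + t • v) v v v) := by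
  have hopen : IsOpen {t : ℝ | x + t • v ∈ D} :=
    hD.preimage (by fun_prop : Continuous fun t : ℝ => x + t • v)
  have h1 : ∀ t : ℝ, x + t • v ∈ D → iteratedDeriv 1 (fun s : ℝ => Φ (x + s • v)) t =
      fderiv ℝ Φ (x + t • v) v := fun t ht => by
    rw [iteratedDeriv_one]
    exact (hasDerivAt_comp_line
      ((contDiffAt_fderivs hD hΦ ht).1.differentiableAt (by norm_num))).deriv
  have h2 : ∀ t : ℝ, x + t • v ∈ D → iteratedDeriv 2 (fun s : ℝ => Φ (x + s • v)) t =
      fderiv ℝ (fderiv ℝ Φ) (x + t • v) v v := fun t ht => by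
    rw [iteratedDeriv_succ]
    have heq : iteratedDeriv 1 (fun s : ℝ => Φ (x + s • v)) =ᶠ[𝓝 t]
        fun s => fderiv ℝ Φ (x + s • v) v := by
      filter_upwards [hopen.mem_nhds ht] with s hs using h1 s hs
    rw [heq.deriv_eq]
    exact (hasDerivAt_fderiv_line v
      ((contDiffAt_fderivs hD hΦ ht).2.1.differentiableAt (by norm_num))).deriv
  refine ⟨h2, fun t ht => ?_⟩
  rw [iteratedDeriv_succ]
  have heq : iteratedDeriv 2 (fun s : ℝ => Φ (x + s • v)) =ᶠ[𝓝 t]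
      fun s => fderiv ℝ (fderiv ℝ Φ) (x + s • v) v v := by
    filter_upwards [hopen.mem_nhds ht] with s hs using h2 s hs
  rw [heq.deriv_eq]
  have h3 := ((hasDerivAt_comp_line (x := x) (v := v) (t := t)
    ((contDiffAt_fderivs hD hΦ ht).2.2.differentiableAt (by norm_num))).clm_apply
      (hasDerivAt_const t v)).clm_apply (hasDerivAt_const t v)
  simpa using h3.deriv

/-- For a self-concordant function the kernel of the Hessian does not depend on the point. -/
theorem second_fderiv_eq_zero_of_selfConcordant (hD : IsOpen D) (hconv : ConvexOn ℝ D Φ)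
    (hΦ : ContDiffOn ℝ 3 Φ D)
    (h3 : ∀ x ∈ D, ∀ v, |fderiv ℝ (fderiv ℝ (fderiv ℝ Φ)) x v v v| ≤
      2 * (fderiv ℝ (fderiv ℝ Φ) x v v) ^ ((3 : ℝ) / 2))
    {x y z : E} (hx : x ∈ D) (hy : y ∈ D) (h0 : fderiv ℝ (fderiv ℝ Φ) x z z = 0) :
    fderiv ℝ (fderiv ℝ Φ) y z z = 0 := by
  set u := y - x with hu
  have hmem : ∀ t ∈ Icc (0 : ℝ) 1, x + t • u ∈ D := fun t ht =>
    hconv.1.add_smul_sub_mem hx hy ht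
  have hderiv : ∀ w, ∀ t ∈ Icc (0 : ℝ) 1,
      HasDerivAt (fun s : ℝ => fderiv ℝ (fderiv ℝ Φ) (x + s • u) w w)
        (fderiv ℝ (fderiv ℝ (fderiv ℝ Φ)) (x + t • u) u w w) t := fun w t ht => by
    have := ((hasDerivAt_comp_line (x := x) (v := u) (t := t)
      ((contDiffAt_fderivs hD hΦ (hmem t ht)).2.2.differentiableAt (by norm_num))).clm_apply
        (hasDerivAt_const t w)).clm_apply (hasDerivAt_const t w)
    simpa using this
  have hcont : ∀ w, ContinuousOn (fun s : ℝ => fderiv ℝ (fderiv ℝ Φ) (x + s • u) w w)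
      (Icc 0 1) := fun w t ht => (hderiv w t ht).continuousAt.continuousWithinAt
  obtain ⟨M, hM⟩ := isCompact_Icc.bddAbove_image (hcont u)
  have hM' : ∀ t ∈ Icc (0 : ℝ) 1, fderiv ℝ (fderiv ℝ Φ) (x + t • u) u u ≤ M := fun t ht =>
    hM (mem_image_of_mem _ ht)
  have hnn : ∀ p ∈ D, ∀ v, 0 ≤ fderiv ℝ (fderiv ℝ Φ) p v v := fun p hp v =>
    convexOn_second_fderiv_nonneg hD hconv
      (fun q hq => (contDiffAt_fderivs hD hΦ hq).1.differentiableAt (by norm_num)) hp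
      ((contDiffAt_fderivs hD hΦ hp).2.1.differentiableAt (by norm_num)) v
  -- Grönwall: φ(s) = D²Φ(x + s u)[z, z] satisfies |φ'| ≤ const · φ on the segment and φ(0) = 0. The
  -- constant is finite because D²Φ[u, u] is bounded on the compact segment.
  have := eq_zero_of_abs_deriv_le_mul_abs_self_of_eq_zero_right
    (K := 2 * (2 * M + 2) ^ ((3 : ℝ) / 2)) (hcont z)
    (fun t ht => (hderiv z t (Ico_subset_Icc_self ht)).hasDerivWithinAt) (by simpa using h0)
    (fun t ht => by
      have ht' := hmem t (Ico_subset_Icc_self ht)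
      rw [Real.norm_eq_abs, Real.norm_of_nonneg (hnn _ ht' z)]
      exact abs_trilinear_le _ _ (third_fderiv_symm_left hD hΦ ht')
        (third_fderiv_symm_right hD hΦ ht') (hnn _ ht') (h3 _ ht')
        (hM' t (Ico_subset_Icc_self ht)) z)
    1 (by simp)
  simpa [hu] using this

/-- The gradient of a self-concordant function with a nondegenerate Hessian at one point is strictly
monotone. -/
theorem fderiv_lt_fderiv_of_selfConcordant (hD : IsOpen D) (hconv : ConvexOn ℝ D Φ)
    (hΦ : ContDiffOn ℝ 3 Φ D)
    (h3 : ∀ x ∈ D, ∀ v, |fderiv ℝ (fderiv ℝ (fderiv ℝ Φ)) x v v v| ≤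
      2 * (fderiv ℝ (fderiv ℝ Φ) x v v) ^ ((3 : ℝ) / 2))
    {p : E} (hp : p ∈ D) (hpos : ∀ v, v ≠ 0 → 0 < fderiv ℝ (fderiv ℝ Φ) p v v)
    {x y : E} (hx : x ∈ D) (hy : y ∈ D) (hxy : x ≠ y) :
    fderiv ℝ Φ x (y - x) < fderiv ℝ Φ y (y - x) := by
  by_contra! hle
  have h0 := convexOn_second_fderiv_eq_zero (z := y - x) hconv
    (fun q hq => (contDiffAt_fderivs hD hΦ hq).1.differentiableAt (by norm_num)) hx (by simpa)
    ((contDiffAt_fderivs hD hΦ hx).2.1.differentiableAt (by norm_num)) (by simpa using hle)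
  have h1 := second_fderiv_eq_zero_of_selfConcordant hD hconv hΦ h3 hx hp h0
  exact (hpos (y - x) (sub_ne_zero.2 hxy.symm)).ne' h1

/-- The secant error is controlled by the distances of the two points to the base point. -/
theorem exists_norm_fderiv_sub_le (hD : IsOpen D) (hΦ : ContDiffOn ℝ 3 Φ D) {p : E} (hp : p ∈ D) :
    ∃ K : ℝ, 0 ≤ K ∧ ∃ r > 0, ∀ x y : E, ‖x - p‖ < r → ‖y - p‖ < r →
      ‖fderiv ℝ Φ y - fderiv ℝ Φ x - fderiv ℝ (fderiv ℝ Φ) p (y - x)‖ ≤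
        K * (‖x - p‖ + ‖y - p‖) * ‖y - x‖ := by
  obtain ⟨K, t, ht, hL⟩ := (contDiffAt_fderivs hD hΦ hp).2.2.exists_lipschitzOnWith
  obtain ⟨r, hr, hball⟩ := Metric.mem_nhds_iff.1 (inter_mem ht (hD.mem_nhds hp))
  refine ⟨K, K.2, r, hr, fun x y hx hy => ?_⟩
  -- The closed ball of this radius is convex and contains both points, and on it D²Φ differs from
  -- its value at p by at most Kρ; the mean value inequality gives the estimate.
  set ρ := max ‖x - p‖ ‖y - p‖ with hρ
  have hsub : Metric.closedBall p ρ ⊆ Metric.ball p r :=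
    Metric.closedBall_subset_ball (max_lt hx hy)
  have := (convex_closedBall p ρ).norm_image_sub_le_of_norm_fderiv_le' (𝕜 := ℝ)
    (f := fderiv ℝ Φ) (φ := fderiv ℝ (fderiv ℝ Φ) p) (C := K * ρ) (x := x) (y := y)
    (fun q hq => (contDiffAt_fderivs hD hΦ (hball (hsub hq)).2).2.1.differentiableAt (by norm_num))
    (fun q hq => by
      have h1 := hL.dist_le_mul q (hball (hsub hq)).1 p (mem_of_mem_nhds ht)
      rw [dist_eq_norm] at h1
      exact h1.trans (mul_le_mul_of_nonneg_left hq K.2))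
    (by simp [hρ, dist_eq_norm]) (by simp [hρ, dist_eq_norm])
  refine this.trans ?_
  gcongr
  exact max_le (by linarith [norm_nonneg (y - p)]) (by linarith [norm_nonneg (x - p)])

end SelfConcordant

/-! ### Passage from extended-real functions to real values, gradients and Hessian matrices. -/

section ExtendedReal

open Set Filter Topology

variable {n : ℕ} {f g : RVec n → EReal}

theorem IsProperClosedConvex.coe_realValue (hf : IsProperClosedConvex f) {x : RVec n}
    (hx : x ∈ effDom f) : ((realValue f x : ℝ) : EReal) = f x :=
  EReal.coe_toReal (ne_of_lt hx) (hf.ne_bot x)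

theorem IsProperClosedConvex.convexOn_realValue (hf : IsProperClosedConvex f) :
    ConvexOn ℝ (effDom f) (realValue f) := by
  have key : ∀ x ∈ effDom f, ∀ y ∈ effDom f, ∀ a b : ℝ, 0 ≤ a → 0 ≤ b → a + b = 1 →
      f (a • x + b • y) ≤ ((a * realValue f x + b * realValue f y : ℝ) : EReal) := by
    intro x hx y hy a b ha hb hab
    have := hf.convex_epigraph (x := (x, realValue f x)) (hf.coe_realValue hx).ge
      (y := (y, realValue f y)) (hf.coe_realValue hy).ge ha hb hab
    simpa using this
  have hdom : Convex ℝ (effDom f) := fun x hx y hy a b ha hb hab =>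
    (key x hx y hy a b ha hb hab).trans_lt (EReal.coe_lt_top _)
  refine ⟨hdom, fun x hx y hy a b ha hb hab => ?_⟩
  have h1 := key x hx y hy a b ha hb hab
  rw [← hf.coe_realValue (hdom hx hy ha hb hab), EReal.coe_le_coe_iff] at h1
  simpa using h1

theorem effDom_compositeObj (hf : IsProperClosedConvex f) (hg : IsProperClosedConvex g) :
    effDom (compositeObj f g) = effDom f ∩ effDom g := by
  ext x
  simp only [effDom, compositeObj, mem_ofPred_eq, mem_inter_iff, lt_top_iff_ne_top]
  constructor
  · intro h
    refine ⟨fun h1 => h ?_, fun h1 => h ?_⟩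
    · rw [h1, EReal.top_add_of_ne_bot (hg.ne_bot x)]
    · rw [h1, EReal.add_top_of_ne_bot (hf.ne_bot x)]
  · rintro ⟨h1, h2⟩
    exact EReal.add_ne_top h1 h2

theorem IsStdSelfConcordant.third_fderiv_le (hf : IsStdSelfConcordant f) :
    ∀ x ∈ effDom f, ∀ v, |fderiv ℝ (fderiv ℝ (fderiv ℝ (realValue f))) x v v v| ≤
      2 * (fderiv ℝ (fderiv ℝ (realValue f)) x v v) ^ ((3 : ℝ) / 2) := by
  intro x hx v
  have hx0 : x + (0 : ℝ) • v ∈ effDom f := by simpa using hx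
  have h := hf.third_le x hx v 0 hx0
  obtain ⟨h2, h3⟩ := iteratedDeriv_line hf.isOpen_dom hf.contDiffOn x v
  rw [h2 0 hx0, h3 0 hx0] at h
  simpa using h

theorem IsStdSelfConcordant.differentiableAt (hf : IsStdSelfConcordant f) {x : RVec n}
    (hx : x ∈ effDom f) : DifferentiableAt ℝ (realValue f) x :=
  (contDiffAt_fderivs hf.isOpen_dom hf.contDiffOn hx).1.differentiableAt (by norm_num)

theorem inner_grad (f : RVec n → EReal) (x v : RVec n) :
    inner ℝ (grad f x) v = fderiv ℝ (realValue f) x v := by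
  rw [grad, gradient, InnerProductSpace.toDual_symm_apply]

theorem IsStdSelfConcordant.continuousAt_grad (hf : IsStdSelfConcordant f) {x : RVec n}
    (hx : x ∈ effDom f) : ContinuousAt (grad f) x :=
  (InnerProductSpace.toDual ℝ (RVec n)).symm.continuous.continuousAt.comp
    (contDiffAt_fderivs hf.isOpen_dom hf.contDiffOn hx).2.1.continuousAt

theorem IsStdSelfConcordant.add_inner_grad_le (hf : IsStdSelfConcordant f) {x u : RVec n}
    (hx : x ∈ effDom f) (hu : u ∈ effDom f) :
    realValue f x + inner ℝ (grad f x) (u - x) ≤ realValue f u := by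
  rw [inner_grad]
  exact hf.properClosedConvex.convexOn_realValue.add_fderiv_le hx hu (hf.differentiableAt hx)

theorem inner_hessianMatrix (f : RVec n → EReal) (x v w : RVec n) :
    inner ℝ v (matVec (hessianMatrix f x) w) =
      fderiv ℝ (fderiv ℝ (realValue f)) x v w := by
  have hexp : ∀ v : RVec n, v = ∑ i, v i • EuclideanSpace.single i (1 : ℝ) := fun v => by
    have := (EuclideanSpace.basisFun (Fin n) ℝ).sum_repr v
    simpa using this.symm
  conv_rhs => rw [hexp v, hexp w]
  rw [inner_matVec]
  simp only [map_sum, map_smul, sum_apply, smul_apply, smul_eq_mul, dotProduct, Matrix.mulVec,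
    hessianMatrix, Matrix.of_apply, Finset.mul_sum]
  rw [Finset.sum_comm]
  refine Finset.sum_congr rfl fun j _ => Finset.sum_congr rfl fun i _ => ?_
  ring

/-- The gradient of `f` is strictly monotone if the Hessian is positive definite at one point. -/
theorem IsStdSelfConcordant.inner_grad_sub_pos (hf : IsStdSelfConcordant f) {p : RVec n}
    (hp : p ∈ effDom f) (hreg : (hessianMatrix f p).PosDef) {x y : RVec n}
    (hx : x ∈ effDom f) (hy : y ∈ effDom f) (hxy : x ≠ y) :
    0 < inner ℝ (grad f y - grad f x) (y - x) := by
  rw [inner_sub_left, inner_grad, inner_grad, sub_pos]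
  refine fderiv_lt_fderiv_of_selfConcordant hf.isOpen_dom
    hf.properClosedConvex.convexOn_realValue hf.contDiffOn hf.third_fderiv_le hp
    (fun v hv => ?_) hx hy hxy
  rw [← inner_hessianMatrix]
  exact inner_matVec_pos hreg hv

/-- The secant error relative to the Hessian at a fixed point. -/
theorem IsStdSelfConcordant.exists_norm_grad_sub_le (hf : IsStdSelfConcordant f) {p : RVec n}
    (hp : p ∈ effDom f) (hreg : (hessianMatrix f p).PosDef) :
    ∃ K : ℝ, 0 ≤ K ∧ ∃ r > 0, ∀ x y : RVec n, ‖x - p‖ < r → ‖y - p‖ < r →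
      ‖grad f y - grad f x - matVec (hessianMatrix f p) (y - x)‖ ≤
        K * (‖x - p‖ + ‖y - p‖) * ‖y - x‖ := by
  obtain ⟨K, hK, r, hr, h⟩ := exists_norm_fderiv_sub_le hf.isOpen_dom hf.contDiffOn hp
  refine ⟨K, hK, r, hr, fun x y hx hy => le_trans ?_ (h x y hx hy)⟩
  set w := grad f y - grad f x - matVec (hessianMatrix f p) (y - x) with hw
  -- Pairing w with itself turns the operator norm bound on the derivative error into a bound on
  -- ‖w‖.
  have h1 : inner ℝ w w = (fderiv ℝ (realValue f) y - fderiv ℝ (realValue f) x -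
      fderiv ℝ (fderiv ℝ (realValue f)) p (y - x)) w := by
    simp only [sub_apply]
    rw [← inner_grad, ← inner_grad, ← inner_hessianMatrix,
      inner_matVec_comm hreg.isHermitian, ← inner_sub_left, real_inner_comm (matVec _ _) w,
      ← inner_sub_left]
  rw [real_inner_self_eq_norm_sq] at h1
  have h2 := (le_abs_self _).trans (ContinuousLinearMap.le_opNorm (fderiv ℝ (realValue f) y -
    fderiv ℝ (realValue f) x - fderiv ℝ (fderiv ℝ (realValue f)) p (y - x)) w)
  rw [← h1] at h2
  rcases (norm_nonneg w).eq_or_lt with h0 | h0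
  · rw [← h0]
    positivity
  · nlinarith

end ExtendedReal

/-! ### First-order optimality conditions as subgradients relative to dom F. -/

section Subgradient

open Set Filter Topology

variable {n : ℕ} {f g : RVec n → EReal}

/-- `ξ` is a subgradient at `p` of the restriction of `φ` to `D`. -/
structure IsSubgradOn (D : Set (RVec n)) (φ : RVec n → ℝ) (p ξ : RVec n) : Prop where
  mem : p ∈ D
  le : ∀ u ∈ D, φ p + inner ℝ ξ (u - p) ≤ φ u

theorem IsSubgradOn.inner_sub_nonneg {D : Set (RVec n)} {φ : RVec n → ℝ} {p q ξ η : RVec n}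
    (h : IsSubgradOn D φ p ξ) (h' : IsSubgradOn D φ q η) : 0 ≤ inner ℝ (η - ξ) (q - p) := by
  have h1 := h.le q h'.mem
  have h2 := h'.le p h.mem
  rw [← neg_sub q p, inner_neg_right] at h2
  rw [inner_sub_left]
  linarith

theorem nonneg_of_forall_mul_add_sq_mul {a b : ℝ}
    (h : ∀ t : ℝ, 0 < t → t ≤ 1 → 0 ≤ t * a + t ^ 2 * b) : 0 ≤ a := by
  have hlim : Tendsto (fun t : ℝ => a + t * b) (𝓝[>] 0) (𝓝 a) := by
    have : Continuous fun t : ℝ => a + t * b := by fun_prop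
    have := (this.tendsto 0).mono_left (nhdsWithin_le_nhds (s := Ioi (0 : ℝ)))
    simpa using this
  refine ge_of_tendsto hlim ?_
  filter_upwards [Ioc_mem_nhdsGT (zero_lt_one' ℝ)] with t ht
  have := h t ht.1 ht.2
  have h2 : 0 ≤ t * (a + t * b) := by linarith
  exact nonneg_of_mul_nonneg_right h2 ht.1

/-- Optimality condition of the proximal quasi-Newton subproblem. -/
theorem isSubgradOn_of_mem_subproblemSolutions (hf : IsProperClosedConvex f)
    (hg : IsProperClosedConvex g) {H : RMat n} (hH : H.IsHermitian) {xk s : RVec n}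
    (hs : s ∈ subproblemSolutions f g xk H) :
    IsSubgradOn (effDom f ∩ effDom g) (realValue g) s (-grad f xk - matVec H (s - xk)) := by
  obtain ⟨hsD, hmin⟩ := hs
  rw [effDom_compositeObj hf hg] at hsD hmin
  have hminR : ∀ u ∈ effDom f ∩ effDom g,
      surrogate f xk H s + realValue g s ≤ surrogate f xk H u + realValue g u := fun u hu => by
    have := hmin u hu
    rw [← hg.coe_realValue hsD.2, ← hg.coe_realValue hu.2] at this
    exact_mod_cast this
  refine ⟨hsD, fun u hu => ?_⟩
  have hconvD : Convex ℝ (effDom f ∩ effDom g) :=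
    hf.convexOn_realValue.1.inter hg.convexOn_realValue.1
  suffices h : 0 ≤ inner ℝ (grad f xk + matVec H (s - xk)) (u - s)
      + (realValue g u - realValue g s) by
    have e : -grad f xk - matVec H (s - xk) = -(grad f xk + matVec H (s - xk)) := by abel
    rw [e, inner_neg_left]
    linarith
  refine nonneg_of_forall_mul_add_sq_mul (b := 1 / 2 * inner ℝ (u - s) (matVec H (u - s)))
    fun t ht0 ht1 => ?_
  -- Compare s with a point on the segment to u: g changes at most linearly in t by convexity, and
  -- the surrogate is linear in t up to t². The linear coefficient must be nonnegative.
  have h1 := hminR (s + t • (u - s)) (hconvD.add_smul_sub_mem hsD hu ⟨ht0.le, ht1⟩)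
  have h2 : realValue g (s + t • (u - s)) ≤ realValue g s + t * (realValue g u - realValue g s) := by
    have := hg.convexOn_realValue.2 hsD.2 hu.2 (sub_nonneg.2 ht1) ht0.le (sub_add_cancel 1 t)
    have e : s + t • (u - s) = (1 - t) • s + t • u := by
      rw [smul_sub, sub_smul, one_smul]
      abel
    rw [e]
    simp only [smul_eq_mul] at this
    linarith
  have h3 : surrogate f xk H (s + t • (u - s)) = surrogate f xk H s
      + t * inner ℝ (grad f xk + matVec H (s - xk)) (u - s)
      + t ^ 2 * (1 / 2 * inner ℝ (u - s) (matVec H (u - s))) := by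
    have e : s + t • (u - s) - xk = (s - xk) + t • (u - s) := by abel
    unfold surrogate
    rw [e, matVec_add, matVec_smul]
    simp only [inner_add_left, inner_add_right, real_inner_smul_left, real_inner_smul_right]
    rw [inner_matVec_comm hH (s - xk) (u - s), real_inner_comm (u - s) (matVec H (s - xk))]
    ring
  linarith

/-- Optimality condition of the composite problem. -/
theorem IsCompositeSolution.isSubgradOn (hf : IsStdSelfConcordant f) (hg : IsProperClosedConvex g)
    {xs : RVec n} (h : IsCompositeSolution f g xs) :
    IsSubgradOn (effDom f ∩ effDom g) (realValue g) xs (-grad f xs) := by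
  have hfc := hf.properClosedConvex
  obtain ⟨hsD, hmin⟩ := h
  rw [effDom_compositeObj hfc hg] at hsD
  have hminR : ∀ u ∈ effDom f ∩ effDom g,
      realValue f xs + realValue g xs ≤ realValue f u + realValue g u := fun u hu => by
    have := hmin u
    unfold compositeObj at this
    rw [← hg.coe_realValue hsD.2, ← hg.coe_realValue hu.2, ← hfc.coe_realValue hsD.1,
      ← hfc.coe_realValue hu.1] at this
    exact_mod_cast this
  refine ⟨hsD, fun u hu => ?_⟩
  have hconvD : Convex ℝ (effDom f ∩ effDom g) :=
    hfc.convexOn_realValue.1.inter hg.convexOn_realValue.1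
  have hderiv : HasDerivAt (fun t : ℝ => realValue f (xs + t • (u - xs)))
      (inner ℝ (grad f xs) (u - xs)) 0 := by
    have := hasDerivAt_comp_line (Φ := realValue f) (x := xs) (v := u - xs) (t := 0)
      (by simpa using hf.differentiableAt hsD.1)
    simpa [inner_grad] using this
  have hlim := (hasDerivAt_iff_tendsto_slope.1 hderiv).mono_left
    (nhdsWithin_mono (0 : ℝ) (fun t ht => (ne_of_gt ht) : Ioi (0 : ℝ) ⊆ {0}ᶜ))
  suffices hs : realValue g xs - realValue g u ≤ inner ℝ (grad f xs) (u - xs) by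
    rw [inner_neg_left]
    linarith
  refine ge_of_tendsto hlim ?_
  filter_upwards [Ioc_mem_nhdsGT (zero_lt_one' ℝ)] with t ht
  have h1 := hminR _ (hconvD.add_smul_sub_mem hsD hu ⟨ht.1.le, ht.2⟩)
  have h2 : realValue g (xs + t • (u - xs)) ≤
      realValue g xs + t * (realValue g u - realValue g xs) := by
    have := hg.convexOn_realValue.2 hsD.2 hu.2 (sub_nonneg.2 ht.2) ht.1.le (sub_add_cancel 1 t)
    have e : xs + t • (u - xs) = (1 - t) • xs + t • u := by
      rw [smul_sub, sub_smul, one_smul]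
      abel
    rw [e]
    simp only [smul_eq_mul] at this
    linarith
  rw [slope_def_field, sub_zero, le_div_iff₀ ht.1, zero_smul, add_zero]
  linarith

end Subgradient

/-! ### Superlinear decrease of the steps implies superlinear convergence. -/

section Sequences

open Set Filter Topology

/-- A sequence with superlinearly decreasing steps converges superlinearly. -/
theorem exists_tendsto_of_norm_step_le {E : Type*} [NormedAddCommGroup E] [CompleteSpace E]
    {X : ℕ → E} {δ : ℕ → ℝ} (hδ : Tendsto δ atTop (𝓝 0))
    (h : ∀ᶠ k in atTop, ‖X (k + 2) - X (k + 1)‖ ≤ δ k * ‖X (k + 1) - X k‖) :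
    ∃ L, Tendsto X atTop (𝓝 L) ∧ (fun k => X (k + 1) - L) =o[atTop] fun k => X k - L := by
  have hquarter : ∀ᶠ k in atTop, δ k ≤ 1 / 2 :=
    (hδ.eventually (gt_mem_nhds (by norm_num : (0 : ℝ) < 1 / 2))).mono fun k hk => hk.le
  obtain ⟨N, hN⟩ := eventually_atTop.1 (h.and hquarter)
  have hgeom : ∀ k, N ≤ k → ∀ j, dist (X (k + j)) (X (k + (j + 1))) ≤
      2 * ‖X (k + 1) - X k‖ / 2 / 2 ^ j := by
    intro k hk j
    rw [mul_div_cancel_left₀ _ (two_ne_zero' ℝ)]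
    induction j with
    | zero => simp [dist_eq_norm_sub']
    | succ j ih =>
      obtain ⟨h1, h2⟩ := hN (k + j) (by omega)
      rw [dist_eq_norm_sub'] at ih ⊢
      have h3 : ‖X (k + j + 2) - X (k + j + 1)‖ ≤ 1 / 2 * ‖X (k + j + 1) - X (k + j)‖ :=
        h1.trans (by gcongr)
      calc _ ≤ 1 / 2 * ‖X (k + j + 1) - X (k + j)‖ := h3
        _ ≤ 1 / 2 * (‖X (k + 1) - X k‖ / 2 ^ j) := by gcongr; exact ih
        _ = _ := by rw [pow_succ]; field_simp
  obtain ⟨L, hL⟩ := cauchySeq_tendsto_of_complete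
    (cauchySeq_of_le_geometric_two (f := fun j => X (N + j)) (hgeom N le_rfl))
  have hX : Tendsto X atTop (𝓝 L) := by
    rw [← tendsto_add_atTop_iff_nat N]
    simpa [add_comm] using hL
  -- The steps from k on are dominated by a geometric series of ratio 1/2, so the tail is at most
  -- twice its first step.
  have hdist : ∀ k, N ≤ k → ‖X k - L‖ ≤ 2 * ‖X (k + 1) - X k‖ := fun k hk => by
    have := dist_le_of_le_geometric_two_of_tendsto (f := fun j => X (k + j)) (hgeom k hk)
      (a := L) (by
        rw [← tendsto_add_atTop_iff_nat k] at hX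
        simpa [add_comm] using hX) 0
    simpa [dist_eq_norm] using this
  refine ⟨L, hX, Asymptotics.isLittleO_iff.2 fun c hc => ?_⟩
  -- In ‖X_{k+1} - L‖ ≤ 2δ_k(‖X_{k+1} - L‖ + ‖X_k - L‖), the bound 1/4 absorbs half of the left side
  -- and c/4 leaves the factor c.
  have hsmall : ∀ᶠ k in atTop, δ k < min (1 / 4) (c / 4) :=
    hδ.eventually (gt_mem_nhds (by positivity))
  filter_upwards [hsmall, eventually_ge_atTop N] with k hk hkN
  have h1 := hdist (k + 1) (by omega)
  have h2 := (hN k hkN).1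
  have h3 : ‖X (k + 1) - X k‖ ≤ ‖X (k + 1) - L‖ + ‖X k - L‖ := by
    rw [← norm_neg (X k - L)]
    have := norm_add_le (X (k + 1) - L) (-(X k - L))
    rwa [show X (k + 1) - L + -(X k - L) = X (k + 1) - X k by abel] at this
  have k1 : δ k ≤ 1 / 4 := hk.le.trans (min_le_left _ _)
  have k2 : δ k ≤ c / 4 := hk.le.trans (min_le_right _ _)
  rcases le_or_gt (δ k) 0 with hneg | hpos
  · have : ‖X (k + 2) - X (k + 1)‖ ≤ 0 :=
      h2.trans (mul_nonpos_of_nonpos_of_nonneg hneg (norm_nonneg _))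
    have hle : ‖X (k + 1) - L‖ ≤ 0 := by linarith
    exact hle.trans (by positivity)
  · have h4 : ‖X (k + 1) - L‖ ≤ 2 * (δ k * (‖X (k + 1) - L‖ + ‖X k - L‖)) :=
      h1.trans (by
        gcongr
        exact h2.trans (by gcongr))
    have h5 := mul_le_mul_of_nonneg_right k1 (norm_nonneg (X (k + 1) - L))
    have h6 := mul_le_mul_of_nonneg_right k2 (norm_nonneg (X k - L))
    linarith

end Sequences

/-! ### The proximal quasi-Newton iterates: step decrease, identification of the limit, BFGS. -/

section Scheme

open Set Filter Topology

variable {n : ℕ} {f g : RVec n → EReal} {xs : RVec n} {x : ℕ → RVec n} {H : ℕ → RMat n}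

theorem IsFullStepScheme.mem_subproblemSolutions (h : IsFullStepScheme f g x H) (k : ℕ) :
    x (k + 1) ∈ subproblemSolutions f g (x k) (H k) := by
  obtain ⟨s, hs, he⟩ := h.2 k
  rwa [he, add_sub_cancel]

theorem IsFullStepScheme.mem_effDom (h : IsFullStepScheme f g x H) (hf : IsProperClosedConvex f)
    (hg : IsProperClosedConvex g) (k : ℕ) : x k ∈ effDom f ∩ effDom g := by
  rw [← effDom_compositeObj hf hg]
  cases k with
  | zero => exact h.1
  | succ k => exact (h.mem_subproblemSolutions k).1

theorem IsFullStepScheme.isSubgradOn (h : IsFullStepScheme f g x H) (hf : IsProperClosedConvex f)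
    (hg : IsProperClosedConvex g) {k : ℕ} (hH : (H k).PosDef) :
    IsSubgradOn (effDom f ∩ effDom g) (realValue g) (x (k + 1))
      (-grad f (x k) - matVec (H k) (stepVec x k)) :=
  isSubgradOn_of_mem_subproblemSolutions hf hg hH.isHermitian (h.mem_subproblemSolutions k)

/-- Comparison of the iterates with the solution. -/
theorem IsFullStepScheme.inner_grad_sub_le (h : IsFullStepScheme f g x H)
    (hf : IsStdSelfConcordant f) (hg : IsProperClosedConvex g) (hxs : IsCompositeSolution f g xs)
    {k : ℕ} (hH : (H k).PosDef) :
    inner ℝ (grad f (x k) - grad f xs) (x (k + 1) - xs) ≤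
      -inner ℝ (matVec (H k) (stepVec x k)) (x (k + 1) - xs) := by
  have := (hxs.isSubgradOn hf hg).inner_sub_nonneg (h.isSubgradOn hf.properClosedConvex hg hH)
  have e : -grad f (x k) - matVec (H k) (stepVec x k) - -grad f xs =
      -(grad f (x k) - grad f xs) - matVec (H k) (stepVec x k) := by abel
  rw [e, inner_sub_left, inner_neg_left] at this
  linarith

/-- Secant equation, symmetry and monotonicity of the subdifferential of `g` bound the curvature of
the next step. -/
theorem IsFullStepScheme.inner_step_le (h : IsFullStepScheme f g x H)
    (hf : IsProperClosedConvex f) (hg : IsProperClosedConvex g) (hH : ∀ k, (H k).PosDef)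
    (hsec : SatisfiesSecant f x H) (k : ℕ) :
    inner ℝ (stepVec x (k + 1)) (matVec (H (k + 1)) (stepVec x (k + 1))) ≤
      inner ℝ (stepVec x (k + 1)) (matVec (H k) (stepVec x k))
        - inner ℝ (stepVec x k) (matVec (H (k + 1)) (stepVec x (k + 1))) := by
  have h1 := (h.isSubgradOn hf hg (hH k)).inner_sub_nonneg (h.isSubgradOn hf hg (hH (k + 1)))
  have e : -grad f (x (k + 1)) - matVec (H (k + 1)) (stepVec x (k + 1)) -
      (-grad f (x k) - matVec (H k) (stepVec x k)) =
      matVec (H k) (stepVec x k) - matVec (H (k + 1)) (stepVec x (k + 1)) - gradDiff f x k := by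
    unfold gradDiff
    abel
  have e2 : x (k + 1 + 1) - x (k + 1) = stepVec x (k + 1) := rfl
  rw [e, e2, ← hsec k, real_inner_comm, inner_sub_right, inner_sub_right,
    inner_matVec_comm (hH (k + 1)).isHermitian (stepVec x (k + 1)) (stepVec x k)] at h1
  linarith

/-- The Dennis–Moré condition in the Euclidean norm. -/
theorem DennisMore.exists_norm_le (hreg : (hessianMatrix f xs).PosDef)
    (hDM : DennisMore f xs x H) :
    ∃ η : ℕ → ℝ, Tendsto η atTop (𝓝 0) ∧ (∀ k, 0 ≤ η k) ∧
      ∀ k, ‖matVec (H k - hessianMatrix f xs) (stepVec x k)‖ ≤ η k * ‖stepVec x k‖ := by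
  obtain ⟨c, C, hc, hC, hG⟩ := exists_weightedNorm_equiv hreg
  obtain ⟨c', C', hc', hC', hG'⟩ := exists_weightedNorm_equiv hreg.inv
  refine ⟨fun k => C / c' * (dualLocalNorm f xs (matVec (H k - hessianMatrix f xs) (stepVec x k)) /
      localNorm f xs (stepVec x k)), by simpa using hDM.const_mul (C / c'),
    fun k => mul_nonneg (by positivity) (div_nonneg (Real.sqrt_nonneg _) (Real.sqrt_nonneg _)),
    fun k => ?_⟩
  rcases eq_or_ne (stepVec x k) 0 with h0 | h0
  · simp [h0, matVec_zero]
  have hpos : 0 < localNorm f xs (stepVec x k) :=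
    (mul_pos hc (norm_pos_iff.2 h0)).trans_le (hG _).1
  set e := matVec (H k - hessianMatrix f xs) (stepVec x k) with he
  have h1 : c' * ‖e‖ ≤ dualLocalNorm f xs e := (hG' e).1
  have h2 : localNorm f xs (stepVec x k) ≤ C * ‖stepVec x k‖ := (hG _).2
  have hd : 0 ≤ dualLocalNorm f xs e := Real.sqrt_nonneg _
  have h3 : dualLocalNorm f xs e ≤
      dualLocalNorm f xs e / localNorm f xs (stepVec x k) * (C * ‖stepVec x k‖) := by
    calc dualLocalNorm f xs e
        = dualLocalNorm f xs e / localNorm f xs (stepVec x k) * localNorm f xs (stepVec x k) := by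
          rw [div_mul_cancel₀ _ hpos.ne']
      _ ≤ _ := by gcongr
  have h4 : ‖e‖ ≤ (dualLocalNorm f xs e / localNorm f xs (stepVec x k) * (C * ‖stepVec x k‖)) / c' :=
    (le_div_iff₀' hc').2 (h1.trans h3)
  refine h4.trans (le_of_eq ?_)
  ring

/-- Under the secant equation and the Dennis–Moré condition the steps decrease superlinearly. -/
theorem IsFullStepScheme.exists_norm_step_le (h : IsFullStepScheme f g x H)
    (hf : IsProperClosedConvex f) (hg : IsProperClosedConvex g)
    (hreg : (hessianMatrix f xs).PosDef) (hH : ∀ k, (H k).PosDef)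
    (hsec : SatisfiesSecant f x H) (hDM : DennisMore f xs x H) :
    ∃ δ : ℕ → ℝ, Tendsto δ atTop (𝓝 0) ∧
      ∀ᶠ k in atTop, ‖x (k + 2) - x (k + 1)‖ ≤ δ k * ‖x (k + 1) - x k‖ := by
  obtain ⟨c, hc, hG⟩ := exists_le_inner_matVec hreg
  obtain ⟨η, hη, hη0, hle⟩ := hDM.exists_norm_le hreg
  have hη' : Tendsto (fun k => η (k + 1)) atTop (𝓝 0) := (tendsto_add_atTop_iff_nat 1).2 hη
  refine ⟨fun k => 2 / c * (η k + η (k + 1)), by simpa using (hη.add hη').const_mul (2 / c), ?_⟩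
  -- Once η (k + 1) < c / 2, the term η (k + 1)‖z'‖² is absorbed by half of the coercivity bound
  -- c‖z'‖²; this is the origin of the factor 2 / c.
  filter_upwards [hη'.eventually (gt_mem_nhds (half_pos hc))] with k hk
  change ‖stepVec x (k + 1)‖ ≤ _ * ‖stepVec x k‖
  set z := stepVec x k with hz
  set z' := stepVec x (k + 1) with hz'
  have hstep := h.inner_step_le hf hg hH hsec k
  rw [← hz, ← hz'] at hstep
  have hl := hle k
  have hl' := hle (k + 1)
  rw [← hz] at hl
  rw [← hz'] at hl'
  set e := matVec (H k - hessianMatrix f xs) z with he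
  set e' := matVec (H (k + 1) - hessianMatrix f xs) z' with he'
  have d : matVec (H k) z = matVec (hessianMatrix f xs) z + e := by
    rw [he, sub_matVec]
    abel
  have d' : matVec (H (k + 1)) z' = matVec (hessianMatrix f xs) z' + e' := by
    rw [he', sub_matVec]
    abel
  -- The terms ⟨z', G z⟩ and ⟨z, G z'⟩ on the right cancel by symmetry of G, leaving only products
  -- with e and e'.
  rw [d, d', inner_add_right, inner_add_right, inner_add_right,
    inner_matVec_comm hreg.isHermitian z' z] at hstep
  have i1 := (abs_le.1 (abs_real_inner_le_norm z' e)).2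
  have i2 := (abs_le.1 (abs_real_inner_le_norm z e')).1
  have i3 := (abs_le.1 (abs_real_inner_le_norm z' e')).1
  have j1 := mul_le_mul_of_nonneg_left hl (norm_nonneg z')
  have j2 := mul_le_mul_of_nonneg_left hl' (norm_nonneg z)
  have j3 := mul_le_mul_of_nonneg_left hl' (norm_nonneg z')
  have j4 : η (k + 1) * ‖z'‖ ^ 2 ≤ c / 2 * ‖z'‖ ^ 2 := by gcongr
  have hmain : ‖z'‖ * (c / 2 * ‖z'‖) ≤ ‖z'‖ * ((η k + η (k + 1)) * ‖z‖) := by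
    linarith [hG z']
  rcases (norm_nonneg z').eq_or_lt with h0 | h0
  · have h1 : 0 ≤ 2 / c * (η k + η (k + 1)) * ‖z‖ :=
      mul_nonneg (mul_nonneg (by positivity) (add_nonneg (hη0 k) (hη0 (k + 1)))) (norm_nonneg z)
    rwa [← h0]
  · have h1 := le_of_mul_le_mul_left hmain h0
    rw [show 2 / c * (η k + η (k + 1)) * ‖z‖ = (η k + η (k + 1)) * ‖z‖ / (c / 2) by
      field_simp, le_div_iff₀ (by positivity)]
    linarith

/-- The limit of a convergent sequence of iterates is the solution. -/
theorem IsFullStepScheme.tendsto_solution (h : IsFullStepScheme f g x H)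
    (hf : IsStdSelfConcordant f) (hg : IsProperClosedConvex g) (hxs : IsCompositeSolution f g xs)
    (hreg : (hessianMatrix f xs).PosDef) (hH : ∀ k, (H k).PosDef) (hDM : DennisMore f xs x H)
    {L : RVec n} (hL : Tendsto x atTop (𝓝 L)) : L = xs := by
  have hfc := hf.properClosedConvex
  have hxsD := (hxs.isSubgradOn hf hg).mem.1
  have hL1 : Tendsto (fun k => x (k + 1)) atTop (𝓝 L) := (tendsto_add_atTop_iff_nat 1).2 hL
  have hz : Tendsto (stepVec x) atTop (𝓝 0) := by
    have := hL1.sub hL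
    rwa [sub_self] at this
  have hHz : Tendsto (fun k => matVec (H k) (stepVec x k)) atTop (𝓝 0) := by
    obtain ⟨η, hη, -, hle⟩ := hDM.exists_norm_le hreg
    obtain ⟨C, hC, hCle⟩ := exists_norm_matVec_le (hessianMatrix f xs)
    refine squeeze_zero_norm (a := fun k => (C + η k) * ‖stepVec x k‖) (fun k => ?_) ?_
    · have e : matVec (H k) (stepVec x k) = matVec (hessianMatrix f xs) (stepVec x k) +
          matVec (H k - hessianMatrix f xs) (stepVec x k) := by
        rw [sub_matVec]
        abel
      rw [e, add_mul]
      exact (norm_add_le _ _).trans (add_le_add (hCle _) (hle k))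
    · simpa using (hη.const_add C).mul hz.norm
  have hrhs : Tendsto (fun k => -inner ℝ (matVec (H k) (stepVec x k)) (x (k + 1) - xs))
      atTop (𝓝 0) := by
    simpa using (hHz.inner (𝕜 := ℝ) (hL1.sub_const xs)).neg
  by_cases hLD : L ∈ effDom f
  · have hlhs := (((hf.continuousAt_grad hLD).tendsto.comp hL).sub_const (grad f xs)).inner
      (𝕜 := ℝ) (hL1.sub_const xs)
    have hle := le_of_tendsto_of_tendsto' hlhs hrhs fun k =>
      h.inner_grad_sub_le hf hg hxs (hH k)
    by_contra hne
    exact absurd (hf.inner_grad_sub_pos hxsD hreg hxsD hLD (Ne.symm hne)) (not_lt.2 hle)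
  · exfalso
    have hLtop : f L = ⊤ := not_lt_top_iff.1 hLD
    have hgr : Tendsto (fun k => inner ℝ (grad f xs) (x (k + 1) - xs)) atTop
        (𝓝 (inner ℝ (grad f xs) (L - xs))) :=
      tendsto_const_nhds.inner (hL1.sub_const xs)
    -- The gradient inequality at x^k is tested at xs - z_k rather than xs: the displacement from
    -- x^k is then exactly -(x^{k+1} - xs), the vector in the optimality estimate, and f stays
    -- bounded at these points because they tend to xs.
    have hback : Tendsto (fun k => xs - stepVec x k) atTop (𝓝 xs) := by
      simpa using hz.const_sub xs
    have hnear : ∀ᶠ k in atTop, xs - stepVec x k ∈ effDom f ∧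
        realValue f (xs - stepVec x k) < realValue f xs + 1 :=
      (hback.eventually (hf.isOpen_dom.mem_nhds hxsD)).and
        (hback.eventually ((hf.differentiableAt hxsD).continuousAt.eventually
          (gt_mem_nhds (lt_add_one _))))
    set B := inner ℝ (grad f xs) (L - xs) with hB
    -- Lower semicontinuity makes f(x^k) exceed any level. The 3 collects one unit of slack each
    -- from f near xs, from the convergence to B, and from the null right-hand side.
    have hbig : ∀ᶠ k in atTop, ((realValue f xs + B + 3 : ℝ) : EReal) < f (x k) :=
      hL.eventually (hfc.lsc L _ (show _ < f L by rw [hLtop]; exact EReal.coe_lt_top _))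
    obtain ⟨k, ⟨hk1, hk2⟩, hk3, hk4, hk5⟩ := (hnear.and (hbig.and
      ((hgr.eventually (gt_mem_nhds (lt_add_one _))).and
        (hrhs.eventually (gt_mem_nhds one_pos))))).exists
    have hxk := (h.mem_effDom hfc hg k).1
    rw [← hfc.coe_realValue hxk, EReal.coe_lt_coe_iff] at hk3
    have h1 := hf.add_inner_grad_le hxk hk1
    have e : xs - stepVec x k - x k = -(x (k + 1) - xs) := by
      unfold stepVec
      abel
    rw [e, inner_neg_right] at h1
    have h2 := h.inner_grad_sub_le hf hg hxs (hH k)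
    rw [inner_sub_left] at h2
    linarith

theorem isLittleO_localNorm (hreg : (hessianMatrix f xs).PosDef)
    (h : (fun k => x (k + 1) - xs) =o[atTop] fun k => x k - xs) :
    (fun k => localNorm f xs (x (k + 1) - xs)) =o[atTop] fun k => localNorm f xs (x k - xs) := by
  obtain ⟨c, C, hc, hC, hG⟩ := exists_weightedNorm_equiv hreg
  have h1 : (fun k => localNorm f xs (x (k + 1) - xs)) =O[atTop] fun k => x (k + 1) - xs :=
    Asymptotics.IsBigO.of_bound C (Eventually.of_forall fun k => by
      rw [Real.norm_of_nonneg (show 0 ≤ localNorm f xs (x (k + 1) - xs) from Real.sqrt_nonneg _)]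
      exact (hG _).2)
  have h2 : (fun k => x k - xs) =O[atTop] fun k => localNorm f xs (x k - xs) :=
    Asymptotics.IsBigO.of_bound c⁻¹ (Eventually.of_forall fun k => by
      rw [Real.norm_of_nonneg (show 0 ≤ localNorm f xs (x k - xs) from Real.sqrt_nonneg _), ← div_eq_inv_mul, le_div_iff₀' hc]
      exact (hG _).1)
  exact (h1.trans_isLittleO h).trans_isBigO h2

theorem IsFullStepScheme.convergesSuperlinearly (h : IsFullStepScheme f g x H)
    (hf : IsStdSelfConcordant f) (hg : IsProperClosedConvex g) (hxs : IsCompositeSolution f g xs)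
    (hreg : (hessianMatrix f xs).PosDef) (hH : ∀ k, (H k).PosDef)
    (hsec : SatisfiesSecant f x H) (hDM : DennisMore f xs x H) :
    ConvergesSuperlinearly f xs x := by
  obtain ⟨δ, hδ, hstep⟩ := h.exists_norm_step_le hf.properClosedConvex hg hreg hH hsec hDM
  obtain ⟨L, hL, hlittle⟩ := exists_tendsto_of_norm_step_le hδ hstep
  obtain rfl := h.tendsto_solution hf hg hxs hreg hH hDM hL
  exact ⟨hL, isLittleO_localNorm hreg hlittle⟩

/-- If the scheme makes a zero step, then the solution has been reached. -/
theorem IsFullStepScheme.eq_solution_of_stepVec_eq_zero (h : IsFullStepScheme f g x H)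
    (hf : IsStdSelfConcordant f) (hg : IsProperClosedConvex g) (hxs : IsCompositeSolution f g xs)
    (hreg : (hessianMatrix f xs).PosDef) {k : ℕ} (hH : (H k).PosDef) (hz : stepVec x k = 0) :
    x k = xs := by
  have hxsD := (hxs.isSubgradOn hf hg).mem.1
  have h1 := h.inner_grad_sub_le hf hg hxs hH
  have e : x (k + 1) = x k := sub_eq_zero.1 hz
  rw [hz, e, matVec_zero, inner_zero_left, neg_zero] at h1
  by_contra hne
  exact absurd (hf.inner_grad_sub_pos hxsD hreg hxsD
    (h.mem_effDom hf.properClosedConvex hg k).1 (Ne.symm hne)) (not_lt.2 h1)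

theorem IsFullStepScheme.inner_gradDiff_stepVec_pos (h : IsFullStepScheme f g x H)
    (hf : IsStdSelfConcordant f) (hg : IsProperClosedConvex g) (hxs : IsCompositeSolution f g xs)
    (hreg : (hessianMatrix f xs).PosDef) {k : ℕ} (hz : stepVec x k ≠ 0) :
    0 < inner ℝ (gradDiff f x k) (stepVec x k) :=
  hf.inner_grad_sub_pos (hxs.isSubgradOn hf hg).mem.1 hreg
    (h.mem_effDom hf.properClosedConvex hg k).1 (h.mem_effDom hf.properClosedConvex hg (k + 1)).1
    fun he => hz (sub_eq_zero.2 he.symm)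

theorem gradDiff_eq_zero {k : ℕ} (hz : stepVec x k = 0) : gradDiff f x k = 0 := by
  rw [gradDiff, sub_eq_zero.1 hz, sub_self]

/-- BFGS matrices satisfy the Dennis–Moré condition if the distances to the solution are
summable. -/
theorem dennisMore_of_isBFGSSequence (hf : IsStdSelfConcordant f) (hxsD : xs ∈ effDom f)
    (hreg : (hessianMatrix f xs).PosDef) (hH : ∀ k, (H k).PosDef) (hB : IsBFGSSequence f x H)
    (hyz : ∀ k, stepVec x k ≠ 0 → 0 < inner ℝ (gradDiff f x k) (stepVec x k))
    (hsum : Summable fun k => localNorm f xs (x k - xs)) : DennisMore f xs x H := by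
  obtain ⟨c, C, hc, hC, hG⟩ := exists_weightedNorm_equiv hreg
  obtain ⟨c', C', hc', hC', hG'⟩ := exists_weightedNorm_equiv hreg.inv
  obtain ⟨K, hK, r, hr, hsecant⟩ := hf.exists_norm_grad_sub_le hxsD hreg
  have hsum' : Summable fun k => ‖x k - xs‖ :=
    Summable.of_nonneg_of_le (fun k => norm_nonneg _)
      (fun k => by rw [← div_eq_inv_mul, le_div_iff₀' hc]; exact (hG _).1) (hsum.mul_left c⁻¹)
  have hnear : ∀ᶠ k in atTop, ‖x k - xs‖ < r :=
    hsum'.tendsto_atTop_zero.eventually (gt_mem_nhds hr)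
  have hnear' : ∀ᶠ k in atTop, ‖x (k + 1) - xs‖ < r :=
    ((tendsto_add_atTop_iff_nat 1).2 hsum'.tendsto_atTop_zero).eventually (gt_mem_nhds hr)
  -- K is the Euclidean secant constant; C' and 1 / c convert the error to the dual norm and the
  -- step to the local norm.
  refine tendsto_dennisMore_of_bfgs (e := fun k => C' * K / c * (‖x k - xs‖ + ‖x (k + 1) - xs‖))
    hreg hH hB hyz (fun k => gradDiff_eq_zero) (fun k => by positivity)
    ((hsum'.add ((summable_nat_add_iff 1).2 hsum')).mul_left _) ?_
  filter_upwards [hnear, hnear'] with k h1 h2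
  calc _ ≤ C' * ‖gradDiff f x k - matVec (hessianMatrix f xs) (stepVec x k)‖ := (hG' _).2
    _ ≤ C' * (K * (‖x k - xs‖ + ‖x (k + 1) - xs‖) * ‖stepVec x k‖) := by
        gcongr
        exact hsecant _ _ h1 h2
    _ ≤ C' * (K * (‖x k - xs‖ + ‖x (k + 1) - xs‖) *
          (weightedNorm (hessianMatrix f xs) (stepVec x k) / c)) := by
        gcongr
        exact (le_div_iff₀' hc).2 (hG _).1
    _ = _ := by ring

end Scheme

theorem mainTheorem4 {n : ℕ} (f g : RVec n → EReal)
    (hf : IsStdSelfConcordant f) (hg : IsProperClosedConvex g)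
    (xs : RVec n) (hxs : IsUniqueCompositeSolution f g xs) (hreg : IsStronglyRegular f xs) :
    -- part (a)
    (∀ (x : ℕ → RVec n) (H : ℕ → RMat n),
      (∀ k, (H k).PosDef) →
      IsFullStepScheme f g x H →
      SatisfiesSecant f x H →
      DennisMore f xs x H →
      localNorm f xs (x 0 - xs) < 1 →
      ConvergesSuperlinearly f xs x) ∧
    -- part (b)
    (∀ (x : ℕ → RVec n) (H : ℕ → RMat n),
      (H 0).PosDef →
      IsFullStepScheme f g x H →
      IsBFGSSequence f x H →
      (∀ k, x k ≠ xs → 0 < (inner ℝ (gradDiff f x k) (stepVec x k) : ℝ)) ∧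
      (∀ k, (H k).PosDef) ∧
      SatisfiesSecant f x H ∧
      (Summable (fun k => localNorm f xs (x k - xs)) → ConvergesSuperlinearly f xs x)) := by
  refine ⟨fun x H hH hx hsec hDM _ =>
    hx.convergesSuperlinearly hf hg hxs.1 hreg hH hsec hDM, fun x H hH0 hx hB => ?_⟩
  have hyz : ∀ k, stepVec x k ≠ 0 → 0 < inner ℝ (gradDiff f x k) (stepVec x k) := fun k hz =>
    hx.inner_gradDiff_stepVec_pos hf hg hxs.1 hreg hz
  have hH : ∀ k, (H k).PosDef := by
    intro k
    induction k with
    | zero => exact hH0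
    | succ k ih =>
      rw [hB k]
      by_cases hz : stepVec x k = 0
      · rwa [hz, gradDiff_eq_zero hz, bfgsUpdate_zero]
      · exact bfgsUpdate_posDef ih (hyz k hz)
  have hsec : SatisfiesSecant f x H := by
    intro k
    by_cases hz : stepVec x k = 0
    · rw [hz, gradDiff_eq_zero hz, matVec_zero]
    · rw [hB k]
      exact bfgsUpdate_secant (hyz k hz).ne' (inner_matVec_pos (hH k) hz).ne'
  refine ⟨fun k hk => hyz k fun hz =>
    hk (hx.eq_solution_of_stepVec_eq_zero hf hg hxs.1 hreg (hH k) hz), hH, hsec, fun hsum => ?_⟩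
  exact hx.convergesSuperlinearly hf hg hxs.1 hreg hH hsec
    (dennisMore_of_isBFGSSequence hf (hxs.1.isSubgradOn hf hg).mem.1 hreg hH hB hyz hsum)
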